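/- Definitions. A complex $m\times m$ matrix has simple spectrum if it has $m$ distinct eigenvalues. For a $2\times2$ matrix function $E=\begin{bmatrix}a&b\\c&d\end{bmatrix}$ of $\xi\in\mathbb R^2$ put $\Delta=(a-d)^2+4bc$ and $F=(\operatorname{Re}\Delta,\operatorname{Im}\Delta)$; the point $\xi_*$ is a generic cuspidal point (GCP) of $E$ if $F(\xi_*)=0$ and the Jacobian $DF(\xi_*)$ is invertible. For $n>2$ and $A\in\mathcal C^k(\Omega,\mathbb C^{n\times n})$, $k\ge1$, a point $\xi_*\in\Omega$ is a GCP of $A$ if there are a closed rectangle $R\subset\Omega$ with $\xi_*$ in its interior and an invertible $T\in\mathcal C^k(R,\mathbb C^{n\times n})$ such that $T^{-1}AT=\operatorname{diag}(E_1,E_2)$ on $R$, where $E_1$ is $2\times2$, $E_1(\xi)$ and $E_2(\xi)$ have no common eigenvalue and $E_2(\xi)$ has simple spectrum for every $\xi\in R$, and $\xi_*$ is a GCP of $E_1$. A smooth Jordan curve is a $\mathcal C^1$ map $\gamma:\mathbb R\to\mathbb R^2$ with minimal positive period $1$ that is one-to-one on $[0,1)$; it encircles a point if the point is not on the curve and lies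 in a bounded connected component of the complement of the curve. Theorem. Let $n\ge5$, $k\ge1$, let $\Omega\subset\mathbb R^2$ be open and convex and $A\in\mathcal C^k(\Omega,\mathbb C^{n\times n})$. Assume that the eigenvalues of $A(\xi)$, counted with algebraic multiplicity, can be labeled $\lambda_1(\xi),\dots,\lambda_n(\xi)$ so that for all $\xi\in\Omega$ the three sets $$\{\lambda_1(\xi),\lambda_2(\xi)\},\qquad\{\lambda_3(\xi),\lambda_4(\xi)\},\qquad\{\lambda_5(\xi),\dots,\lambda_n(\xi)\}$$ are mutually disjoint, and each of these sets depends continuously on $\xi\in\Omega$ in the Hausdorff distance (the individual labels need not be continuous). Let $\xi_0\ne\xi_1$ in $\Omega$ be two GCPs of $A$ with $\lambda_1(\xi_0)=\lambda_2(\xi_0)$ and $\lambda_3(\xi_1)=\lambda_4(\xi_1)$, and suppose that $A(\xi)$ has simple spectrum for all $\xi\in\Omega\setminus\{\xi_0,\xi_1\}$. Let $\gamma:\mathbb R\to\Omega$ be a smooth Jordan curve encircling both $\xi_0$ and $\xi_1$, such that $A(\gamma(\cdot))$ also has minimal positive period $1$. Let $A(\gamma(t))=V(t)\Lambda(t)V^{-1}(t)$,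 $t\in\mathbb R$, be a $\mathcal C^k$ eigendecomposition, with $\Lambda(t)$ diagonal and $V(t)=[v_1(t),\dots,v_n(t)]$ invertible, such that $P=V^{-1}\dot V$ satisfies, for all $t$ and $j$, $$\operatorname{Re}(v_j^*v_jP_{jj})=-\sum_{l\ne j}\operatorname{Re}(v_j^*v_lP_{lj}),\qquad \operatorname{Im}P_{jj}=0,$$ and such that the two columns of $V(0)$ belonging to the eigenvalues $\{\lambda_1(\gamma(0)),\lambda_2(\gamma(0))\}$ have the same Euclidean length, and so have the two columns belonging to $\{\lambda_3(\gamma(0)),\lambda_4(\gamma(0))\}$. Then the diagonal entries of $\Lambda$, and the columns of $V$ accordingly, can be relabeled by one permutation independent of $t$, so that the new diagonal entries, written $\lambda_j(t)$, satisfy $\{\lambda_1(t),\lambda_2(t)\}=\{\lambda_1(\gamma(t)),\lambda_2(\gamma(t))\}$, $\{\lambda_3(t),\lambda_4(t)\}=\{\lambda_3(\gamma(t)),\lambda_4(\gamma(t))\}$, $\{\lambda_5(t),\dots,\lambda_n(t)\}=\{\lambda_5(\gamma(t)),\dots,\lambda_n(\gamma(t))\}$ for all $t$, and there are constants $\alpha_1,\dots,\alpha_n\in\mathbb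 R$ such that for all $t\in\mathbb R$: (i) $\lambda_1(t+1)=\lambda_2(t)$ and $\lambda_2(t+1)=\lambda_1(t)$; (ii) $\lambda_3(t+1)=\lambda_4(t)$ and $\lambda_4(t+1)=\lambda_3(t)$; (iii) $\lambda_j(t+1)=\lambda_j(t)$ for all $j\ge5$; (iv) $V^{-1}(t)V(t+1)$ is the block diagonal matrix with diagonal blocks $$\begin{bmatrix}0&e^{i\alpha_2}\\e^{i\alpha_1}&0\end{bmatrix},\quad\begin{bmatrix}0&e^{i\alpha_4}\\e^{i\alpha_3}&0\end{bmatrix},\quad e^{i\alpha_5},\ \dots,\ e^{i\alpha_n},$$ and $\sum_{j=1}^n\alpha_j=0\bmod 2\pi$. -/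

import Mathlib

/-- A matrix valued function `M` is of class `C^k` (over the reals) on `s`: every entry is. -/
def MatContDiffOn {X p q : Type*} [NormedAddCommGroup X] [NormedSpace ℝ X]
    (k : ℕ∞) (M : X → Matrix p q ℂ) (s : Set X) : Prop :=
  ∀ i j, ContDiffOn ℝ (k : WithTop ℕ∞) (fun ξ => M ξ i j) s

/-- The spectrum of a complex square matrix is simple: the roots of the characteristic polynomial
(there are as many as the size of the matrix, with multiplicity) are pairwise distinct. -/
def SimpleSpectrum {p : Type*} [Fintype p] [DecidableEq p] (M : Matrix p p ℂ) : Prop :=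
  M.charpoly.roots.Nodup

/-- `Δ = (a - d)² + 4 b c` for the matrix `[a b; c d]`. -/
def discr2 (M : Matrix (Fin 2) (Fin 2) ℂ) : ℂ :=
  (M 0 0 - M 1 1) ^ 2 + 4 * M 0 1 * M 1 0

/-- `F = (Re Δ, Im Δ)` for a two-parameter family of `2 × 2` matrices. -/
def discrMap (E : ℝ × ℝ → Matrix (Fin 2) (Fin 2) ℂ) (ξ : ℝ × ℝ) : ℝ × ℝ :=
  ((discr2 (E ξ)).re, (discr2 (E ξ)).im)

/-- Generic cuspidal point of a two-parameter family of `2 × 2` matrices: a regular zero of the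
map `F`. -/
def IsGCP2 (E : ℝ × ℝ → Matrix (Fin 2) (Fin 2) ℂ) (ξ₀ : ℝ × ℝ) : Prop :=
  discrMap E ξ₀ = 0 ∧ (fderiv ℝ (discrMap E) ξ₀).IsInvertible

/-- Generic cuspidal point of a `C^k` family `A : Ω → ℂ^{n×n}`: on a nondegenerate closed rectangle
`R ⊆ Ω` with `ξ₀` in its interior there is an invertible `C^k` matrix function `T` with
`T⁻¹ A T = diag(E₁, E₂)`, where `E₁` is `2 × 2`, the spectra of `E₁` and `E₂` are disjoint,
`ξ₀` is a generic cuspidal point of `E₁`, and `E₂` has simple spectrum throughout `R`.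
The bijection `e` only fixes an ordering of the columns of `T`. -/
def IsGCP {n : ℕ} (k : ℕ∞) (Ω : Set (ℝ × ℝ)) (A : ℝ × ℝ → Matrix (Fin n) (Fin n) ℂ)
    (ξ₀ : ℝ × ℝ) : Prop :=
  ∃ a₁ b₁ a₂ b₂ : ℝ,
    Set.Icc a₁ b₁ ×ˢ Set.Icc a₂ b₂ ⊆ Ω ∧
    ξ₀ ∈ Set.Ioo a₁ b₁ ×ˢ Set.Ioo a₂ b₂ ∧
    ∃ (e : Fin 2 ⊕ Fin (n - 2) ≃ Fin n)
      (T : ℝ × ℝ → Matrix (Fin n) (Fin n) ℂ)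
      (E₁ : ℝ × ℝ → Matrix (Fin 2) (Fin 2) ℂ)
      (E₂ : ℝ × ℝ → Matrix (Fin (n - 2)) (Fin (n - 2)) ℂ),
      MatContDiffOn k T (Set.Icc a₁ b₁ ×ˢ Set.Icc a₂ b₂) ∧
      (∀ ξ ∈ Set.Icc a₁ b₁ ×ˢ Set.Icc a₂ b₂,
        IsUnit (T ξ).det ∧
        (T ξ)⁻¹ * A ξ * T ξ = Matrix.reindex e e (Matrix.fromBlocks (E₁ ξ) 0 0 (E₂ ξ)) ∧
        Disjoint (spectrum ℂ (E₁ ξ)) (spectrum ℂ (E₂ ξ)) ∧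
        SimpleSpectrum (E₂ ξ)) ∧
      IsGCP2 E₁ ξ₀

/-- `lam 0, …, lam (n-1)` is a labeling of the eigenvalues (with algebraic multiplicity) of `A`
over `Ω`. No continuity of the individual labels is required. -/
def IsEigenvalueLabeling {n : ℕ} (Ω : Set (ℝ × ℝ)) (A : ℝ × ℝ → Matrix (Fin n) (Fin n) ℂ)
    (lam : Fin n → ℝ × ℝ → ℂ) : Prop :=
  ∀ ξ ∈ Ω, (A ξ).charpoly = ∏ j, (Polynomial.X - Polynomial.C (lam j ξ))

/-- The set of values at `ξ` of the labels with indices in `J`. -/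
def labelGroup {n : ℕ} (lam : Fin n → ℝ × ℝ → ℂ) (J : Set (Fin n)) (ξ : ℝ × ℝ) : Set ℂ :=
  (fun j => lam j ξ) '' J

/-- Indices `1, 2` (in 1-based numbering). -/
def firstPair (n : ℕ) : Set (Fin n) := {j | j.val < 2}

/-- Indices `3, 4` (in 1-based numbering). -/
def secondPair (n : ℕ) : Set (Fin n) := {j | 2 ≤ j.val ∧ j.val < 4}

/-- Indices `5, …, n` (in 1-based numbering). -/
def restIndices (n : ℕ) : Set (Fin n) := {j | 4 ≤ j.val}

/-- A family of (finite nonempty) subsets of `ℂ` depends continuously on the parameter in `Ω`,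
with respect to the Hausdorff distance. -/
def SetContinuousOn (G : ℝ × ℝ → Set ℂ) (Ω : Set (ℝ × ℝ)) : Prop :=
  ∀ ξ ∈ Ω, Filter.Tendsto (fun η => Metric.hausdorffDist (G η) (G ξ)) (nhdsWithin ξ Ω) (nhds 0)

/-- `p` is the minimal positive period of `f`. -/
def HasMinimalPeriod {X : Type*} (f : ℝ → X) (p : ℝ) : Prop :=
  0 < p ∧ Function.Periodic f p ∧ ∀ q, 0 < q → Function.Periodic f q → p ≤ q

/-- A smooth parametrized Jordan curve in the plane. -/
structure IsSmoothJordanCurve (γ : ℝ → ℝ × ℝ) : Prop where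
  contDiff : ContDiff ℝ 1 γ
  period : HasMinimalPeriod γ 1
  injOn : Set.InjOn γ (Set.Ico 0 1)

/-- The curve `γ` encircles `ξ`: the point `ξ` is not on the curve and lies in a bounded connected
component of its complement. -/
def Encircles (γ : ℝ → ℝ × ℝ) (ξ : ℝ × ℝ) : Prop :=
  ξ ∉ Set.range γ ∧ Bornology.IsBounded (connectedComponentIn (Set.range γ)ᶜ ξ)

/-- The matrix `P = V⁻¹ V̇`. -/
noncomputable def logDerivMatrix {n : ℕ} (V : ℝ → Matrix (Fin n) (Fin n) ℂ) (t : ℝ) :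
    Matrix (Fin n) (Fin n) ℂ :=
  (V t)⁻¹ * Matrix.of (fun i j => deriv (fun s => V s i j) t)

/-- A `C^k` eigendecomposition `B(t) = V(t) diag(Λ₁(t), …, Λₙ(t)) V(t)⁻¹`, `t ∈ ℝ`, such that,
with `P = V⁻¹ V̇` and `v_j` the columns of `V`,
`Re (v_j^* v_j P_jj) = - ∑_{k ≠ j} Re (v_j^* v_k P_kj)` (columns of constant Euclidean length) and
`Im P_jj = 0` (parallel transport). -/
structure IsTransportedEigendecomposition {n : ℕ} (k : ℕ∞) (B : ℝ → Matrix (Fin n) (Fin n) ℂ)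
    (V : ℝ → Matrix (Fin n) (Fin n) ℂ) (Lam : Fin n → ℝ → ℂ) : Prop where
  contDiff_vectors : MatContDiffOn k V Set.univ
  contDiff_values : ∀ j, ContDiff ℝ (k : WithTop ℕ∞) (Lam j)
  isUnit_det : ∀ t, IsUnit (V t).det
  decomposition : ∀ t, B t = V t * Matrix.diagonal (fun j => Lam j t) * (V t)⁻¹
  real_part : ∀ t j,
    (dotProduct (star ((V t).col j)) ((V t).col j) * logDerivMatrix V t j j).re =
      - ∑ l ∈ Finset.univ.erase j,
        (dotProduct (star ((V t).col j)) ((V t).col l) * logDerivMatrix V t l j).re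
  imag_part : ∀ t j, (logDerivMatrix V t j j).im = 0

/-- Squared Euclidean length of the `j`-th column of a matrix. -/
noncomputable def colNormSq {n : ℕ} (M : Matrix (Fin n) (Fin n) ℂ) (j : Fin n) : ℝ :=
  ∑ i, ‖M i j‖ ^ 2

/-- The permutation of the indices that exchanges `1, 2` and exchanges `3, 4` (1-based). -/
def pairSwap {n : ℕ} (hn : 5 ≤ n) : Equiv.Perm (Fin n) :=
  Equiv.swap (Fin.castLE hn 0) (Fin.castLE hn 1) * Equiv.swap (Fin.castLE hn 2) (Fin.castLE hn 3)

/-- The block diagonal matrix with blocks `[0 e^{iα₂}; e^{iα₁} 0]`, `[0 e^{iα₄}; e^{iα₃} 0]`,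
`e^{iα₅}, …, e^{iαₙ}`: column `j` has the single nonzero entry `e^{iα_j}`, in row `pairSwap j`. -/
noncomputable def twoSwapPhaseMatrix {n : ℕ} (hn : 5 ≤ n) (α : Fin n → ℝ) :
    Matrix (Fin n) (Fin n) ℂ :=
  Matrix.of fun i j => if i = pairSwap hn j then Complex.exp (Complex.I * (α j : ℂ)) else 0

/-! The monodromy of the eigenvalues is decided by the parity of winding numbers, and parity is
encoded by square roots: a nonvanishing 1-periodic function winds evenly or oddly about zero
according as its continuous square roots are 1-periodic or change sign after one period. This
replaces any theory of the index.

Three topological facts feed in. A C¹ Jordan curve winds oddly about each point it encircles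
(`hasAntiperiodicSqrt_sub_of_jordan`): an arc does not separate the plane, so an encircled point can
be joined to a far point by crossing only a short piece of the curve, and such a crossing flips
parity. At a generic cuspidal point the squared difference of the coalescing pair equals a function
with invertible differential. Dividing by that differential leaves a continuous nonvanishing
function on the convex set Ω, which has a square root there; hence the squared difference has
antiperiodic roots along γ (`hasAntiperiodicSqrt_comp`) and the pair is exchanged. Finally, a group
without coalescence is a finite covering of the simply connected Ω, so its branches return to
themselves (`exists_continuous_selection`).

For eigenvectors, simplicity of the spectrum along γ makes V(t+1) equal to V(t) times a monomial
matrix. Constant column lengths make its coefficients unimodular and Im P_jj = 0 makes them constant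
(`exists_phases`). Since tr P is real, det V keeps its argument (`exists_det_eq`); the product of
two transpositions is even, so the phases multiply to a positive number of modulus one, that is, to
1. -/

/-! ### Square roots along a period as parity of the winding number. -/

/-- `f` has a continuous square root along `ℝ` of period `1`. -/
def HasPeriodicSqrt (f : ℝ → ℂ) : Prop :=
  ∃ s : ℝ → ℂ, Continuous s ∧ (∀ t, s t ^ 2 = f t) ∧ ∀ t, s (t + 1) = s t

/-- `f` has a continuous square root along `ℝ` of antiperiod `1`. -/
def HasAntiperiodicSqrt (f : ℝ → ℂ) : Prop :=
  ∃ s : ℝ → ℂ, Continuous s ∧ (∀ t, s t ^ 2 = f t) ∧ ∀ t, s (t + 1) = -s t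

theorem Convex.isSimplyConnected {E : Type*} [AddCommGroup E] [Module ℝ E] [TopologicalSpace E]
    [ContinuousAdd E] [ContinuousSMul ℝ E] {s : Set E} (hs : Convex ℝ s) (hne : s.Nonempty) :
    IsSimplyConnected s :=
  have := hs.contractibleSpace hne
  SimplyConnectedSpace.ofContractible s

theorem exists_continuous_log {X : Type*} [TopologicalSpace X] [AddCommGroup X] [Module ℝ X]
    [ContinuousAdd X] [ContinuousSMul ℝ X] [LocallyPathConnectedSpace X] {f : X → ℂ}
    (hf : Continuous f) (h0 : ∀ x, f x ≠ 0) :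
    ∃ g : X → ℂ, Continuous g ∧ ∀ x, Complex.exp (g x) = f x := by
  obtain ⟨g, hg, hgf⟩ := Complex.exists_continuousOn_eqOn_exp_comp
    (convex_univ.isSimplyConnected (E := X) Set.univ_nonempty) isOpen_univ hf.continuousOn
    (by simpa using h0)
  exact ⟨g, continuousOn_univ.1 hg, fun x => hgf (Set.mem_univ x)⟩

theorem exists_continuous_sqrt {X : Type*} [TopologicalSpace X] [AddCommGroup X] [Module ℝ X]
    [ContinuousAdd X] [ContinuousSMul ℝ X] [LocallyPathConnectedSpace X] {f : X → ℂ}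
    (hf : Continuous f) (h0 : ∀ x, f x ≠ 0) :
    ∃ s : X → ℂ, Continuous s ∧ ∀ x, s x ^ 2 = f x := by
  obtain ⟨g, hg, hgf⟩ := exists_continuous_log hf h0
  refine ⟨fun x => Complex.exp (g x / 2), by fun_prop, fun x => ?_⟩
  rw [← Complex.exp_nat_mul, ← hgf]
  congr 1
  push_cast
  ring

theorem eqOn_or_eqOn_neg_of_sq_eq {S : Set ℝ} (hS : IsPreconnected S) {f g : ℝ → ℂ}
    (hf : ContinuousOn f S) (hg : ContinuousOn g S) (hsq : ∀ t ∈ S, f t ^ 2 = g t ^ 2)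
    (h0 : ∀ t ∈ S, g t ≠ 0) : Set.EqOn f g S ∨ Set.EqOn f (-g) S :=
  hS.eq_or_eq_neg_of_sq_eq hf hg (fun t ht => hsq t ht) (fun {t} ht => h0 t ht)

/-- The shift of a root by one period is again a root of the same function, and two continuous roots
of a nonvanishing function on ℝ differ by a global sign. -/
theorem hasPeriodicSqrt_or_hasAntiperiodicSqrt {f : ℝ → ℂ} (hf : Continuous f)
    (h0 : ∀ t, f t ≠ 0) (hper : ∀ t, f (t + 1) = f t) :
    HasPeriodicSqrt f ∨ HasAntiperiodicSqrt f := by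
  obtain ⟨s, hs, hsf⟩ := exists_continuous_sqrt hf h0
  have hs0 : ∀ t, s t ≠ 0 := fun t h => h0 t (by rw [← hsf, h]; simp)
  rcases eqOn_or_eqOn_neg_of_sq_eq (S := Set.univ) (f := fun t => s (t + 1)) (g := s)
    isPreconnected_univ (by fun_prop) (by fun_prop)
    (fun t _ => by simp only [hsf, hper]) (fun t _ => hs0 t) with h | h
  · exact Or.inl ⟨s, hs, hsf, fun t => h (Set.mem_univ t)⟩
  · exact Or.inr ⟨s, hs, hsf, fun t => h (Set.mem_univ t)⟩

theorem HasPeriodicSqrt.not_hasAntiperiodicSqrt {f : ℝ → ℂ} (h0 : ∀ t, f t ≠ 0)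
    (hp : HasPeriodicSqrt f) : ¬ HasAntiperiodicSqrt f := by
  rintro ⟨s, hs, hsf, hsa⟩
  obtain ⟨r, hr, hrf, hrp⟩ := hp
  have hs0 : ∀ t, s t ≠ 0 := fun t h => h0 t (by rw [← hsf, h]; simp)
  have h2 : s 0 = - s 0 → False := fun h => hs0 0 (self_eq_neg.1 h)
  rcases eqOn_or_eqOn_neg_of_sq_eq (S := Set.univ) (f := r) (g := s)
    isPreconnected_univ (by fun_prop) (by fun_prop)
    (fun t _ => by rw [hsf, hrf]) (fun t _ => hs0 t) with h | h
  · have e0 := h (Set.mem_univ 0)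
    have e1 := h (Set.mem_univ (0 + 1))
    rw [hrp, hsa, e0] at e1
    exact h2 e1
  · have e0 := h (Set.mem_univ 0)
    have e1 := h (Set.mem_univ (0 + 1))
    rw [hrp, Pi.neg_apply, hsa, e0, Pi.neg_apply, neg_neg] at e1
    exact h2 e1.symm

theorem HasAntiperiodicSqrt.mul {f g : ℝ → ℂ} (hf : HasAntiperiodicSqrt f)
    (hg : HasPeriodicSqrt g) : HasAntiperiodicSqrt (fun t => f t * g t) := by
  obtain ⟨s, hs, hsf, hsa⟩ := hf
  obtain ⟨r, hr, hrf, hrp⟩ := hg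
  exact ⟨fun t => s t * r t, by fun_prop, fun t => by rw [mul_pow, hsf, hrf],
    fun t => by simp only [hsa, hrp]; ring⟩

theorem HasPeriodicSqrt.mul {f g : ℝ → ℂ} (hf : HasPeriodicSqrt f)
    (hg : HasPeriodicSqrt g) : HasPeriodicSqrt (fun t => f t * g t) := by
  obtain ⟨s, hs, hsf, hsa⟩ := hf
  obtain ⟨r, hr, hrf, hrp⟩ := hg
  exact ⟨fun t => s t * r t, by fun_prop, fun t => by rw [mul_pow, hsf, hrf],
    fun t => by simp only [hsa, hrp]⟩

/-- The principal square root. -/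
noncomputable def principalSqrt (z : ℂ) : ℂ := Complex.exp (Complex.log z / 2)

theorem principalSqrt_sq {z : ℂ} (hz : z ≠ 0) : principalSqrt z ^ 2 = z := by
  rw [principalSqrt, ← Complex.exp_nat_mul]
  push_cast
  rw [mul_div_cancel₀ _ two_ne_zero, Complex.exp_log hz]

theorem continuousOn_principalSqrt : ContinuousOn principalSqrt Complex.slitPlane := by
  intro z hz
  have := (continuousAt_id.clog hz : ContinuousAt (fun z : ℂ => Complex.log (id z)) z)
  exact (ContinuousAt.cexp (this.div_const 2)).continuousWithinAt

theorem principalSqrt_re_pos {z : ℂ} (hz : z ∈ Complex.slitPlane) : 0 < (principalSqrt z).re := by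
  rw [principalSqrt, Complex.exp_re]
  refine mul_pos (Real.exp_pos _) (Real.cos_pos_of_mem_Ioo ?_)
  have h1 := Complex.neg_pi_lt_arg z
  have h2 := (Complex.arg_le_pi z).lt_of_ne (Complex.mem_slitPlane_iff_arg.1 hz).1
  have : (Complex.log z / 2).im = Complex.arg z / 2 := by
    rw [← Complex.log_im]; simp
  rw [this]
  constructor <;> linarith

/-- Halving the argument keeps a point in its open upper or lower half plane. This detects the sign
change when a loop crosses a ray. -/
theorem principalSqrt_im_sign {z : ℂ} :
    (0 < z.im → 0 < (principalSqrt z).im) ∧ (z.im < 0 → (principalSqrt z).im < 0) := by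
  have h : (principalSqrt z).im = Real.exp (Complex.log z / 2).re * Real.sin (z.arg / 2) := by
    rw [principalSqrt, Complex.exp_im]
    congr 2
    rw [← Complex.log_im]; simp
  have h1 := Complex.neg_pi_lt_arg z
  have h2 := Complex.arg_le_pi z
  rw [h]
  constructor
  · intro hz
    have h3 : 0 < z.arg := by
      refine lt_of_le_of_ne (Complex.arg_nonneg_iff.2 hz.le) fun h => ?_
      rw [eq_comm, Complex.arg_eq_zero_iff] at h
      exact hz.ne' h.2
    exact mul_pos (Real.exp_pos _) (Real.sin_pos_of_pos_of_lt_pi (by linarith) (by linarith))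
  · intro hz
    have h3 : z.arg < 0 := Complex.arg_neg_iff.2 hz
    exact mul_neg_of_pos_of_neg (Real.exp_pos _)
      (Real.sin_neg_of_neg_of_neg_pi_lt (by linarith) (by linarith))

theorem hasPeriodicSqrt_of_mem_slitPlane {f : ℝ → ℂ} (hf : Continuous f)
    (h : ∀ t, f t ∈ Complex.slitPlane) (hper : ∀ t, f (t + 1) = f t) : HasPeriodicSqrt f :=
  ⟨fun t => principalSqrt (f t), continuousOn_principalSqrt.comp_continuous hf h,
    fun t => principalSqrt_sq (Complex.slitPlane_ne_zero (h t)), fun t => by simp only [hper]⟩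

theorem hasPeriodicSqrt_const (z : ℂ) : HasPeriodicSqrt fun _ => z := by
  obtain ⟨w, hw⟩ := IsSquare.exists_sq z (Complex.isSquare z) 
  exact ⟨fun _ => w, continuous_const, fun _ => hw.symm, fun _ => rfl⟩

/-! ### Arcs do not separate the plane. -/

/-- Components of the open set `Kᶜ` are open. A frontier point off `K` would have its own component
meeting this one, so the two would coincide and the point would be interior. -/
theorem frontier_connectedComponentIn_subset {K : Set ℂ} (hK : IsClosed K) (a : ℂ) :
    frontier (connectedComponentIn Kᶜ a) ⊆ K := by
  intro p hp
  by_contra hpK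
  have hpo : IsOpen (connectedComponentIn Kᶜ p) := hK.isOpen_compl.connectedComponentIn
  have hao : IsOpen (connectedComponentIn Kᶜ a) := hK.isOpen_compl.connectedComponentIn
  have hpm : p ∈ connectedComponentIn Kᶜ p := mem_connectedComponentIn hpK
  obtain ⟨z, hz1, hz2⟩ := mem_closure_iff.1 hp.1 _ hpo hpm
  have := (connectedComponentIn_eq hz1).trans (connectedComponentIn_eq hz2).symm
  rw [this] at hpm
  exact hp.2 (hao.interior_eq.symm ▸ hpm)

/-- If `z - a` has a continuous logarithm on the compact set `K`, then `a` does not lie in a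
bounded component of the complement of `K`. -/
theorem not_isBounded_connectedComponentIn_of_log {K : Set ℂ} (hK : IsCompact K) {a : ℂ}
    (ha : a ∉ K) {g : ℂ → ℂ} (hg : ContinuousOn g K) (hexp : ∀ z ∈ K, Complex.exp (g z) = z - a) :
    ¬ Bornology.IsBounded (connectedComponentIn Kᶜ a) := by
  classical
  intro hb
  set U := connectedComponentIn Kᶜ a with hU
  obtain ⟨G, hG⟩ := ContinuousMap.exists_restrict_eq hK.isClosed
    (⟨K.domRestrict g, continuousOn_iff_continuous_domRestrict.1 hg⟩ : C(K, ℂ))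
  have hGg : ∀ z ∈ K, G z = g z := fun z hz => by
    have := DFunLike.congr_fun hG ⟨z, hz⟩
    exact this
  have haU : a ∈ U := mem_connectedComponentIn ha
  -- Gluing: replacing z - a by exp of the extended logarithm inside the bounded component removes
  -- the zero at a, and the two formulas agree on the frontier, which lies in K. The result has a
  -- square root on all of ℂ, yet on a large circle it is still z - a, of odd winding.
  have hF : Continuous fun z => if z ∈ U then Complex.exp (G z) else z - a := by
    refine Continuous.if (fun z hz => ?_) (by fun_prop) (by fun_prop)
    have hzK := frontier_connectedComponentIn_subset hK.isClosed a hz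
    rw [hGg z hzK, hexp z hzK]
  have hF0 : ∀ z, (if z ∈ U then Complex.exp (G z) else z - a) ≠ 0 := by
    intro z
    split_ifs with h
    · exact Complex.exp_ne_zero _
    · exact sub_ne_zero.2 fun h' => h (h' ▸ haU)
  obtain ⟨s, hs, hsF⟩ := exists_continuous_sqrt hF hF0
  obtain ⟨R, hR0, hR⟩ := hb.subset_ball_lt 0 a
  set e : ℝ → ℂ := fun t => Complex.exp (2 * Real.pi * t * Complex.I) with he
  have hnorm : ∀ t, ‖e t‖ = 1 := fun t => by
    have := Complex.norm_exp_ofReal_mul_I (2 * Real.pi * t)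
    push_cast at this
    exact this
  have hper : ∀ t, e (t + 1) = e t := fun t => by
    simp only [he]
    rw [Complex.exp_eq_exp_iff_exists_int]
    exact ⟨1, by push_cast; ring⟩
  have h1 : HasPeriodicSqrt fun t => R * e t := by
    refine ⟨fun t => s (a + R * e t), by fun_prop, fun t => ?_, fun t => by simp only [hper]⟩
    rw [hsF, if_neg]
    · ring
    · intro h
      have := hR h
      rw [Metric.mem_ball, dist_eq_norm, add_sub_cancel_left, norm_mul, hnorm] at this
      simp [abs_of_pos hR0] at this
  have h2 : HasAntiperiodicSqrt e := by
    refine ⟨fun t => Complex.exp (Real.pi * t * Complex.I), by fun_prop, fun t => ?_, fun t => ?_⟩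
    · rw [← Complex.exp_nat_mul]
      simp only [he]
      congr 1
      push_cast
      ring
    · push_cast
      rw [show (Real.pi * (t + 1) * Complex.I : ℂ) = Real.pi * t * Complex.I + Real.pi * Complex.I
        by ring, Complex.exp_add, Complex.exp_pi_mul_I]
      ring
  have h3 : HasAntiperiodicSqrt fun t => R * e t := by
    simpa only [mul_comm] using h2.mul (hasPeriodicSqrt_const R)
  refine h1.not_hasAntiperiodicSqrt (fun t => ?_) h3
  exact mul_ne_zero (by exact_mod_cast hR0.ne') (Complex.exp_ne_zero _)

/-- An arc does not separate the plane. -/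
theorem not_isBounded_connectedComponentIn_compl_arc {c : ℝ → ℂ} (hc : Continuous c) {p q : ℝ}
    (hinj : Set.InjOn c (Set.Icc p q)) {a : ℂ} (ha : a ∉ c '' Set.Icc p q) :
    ¬ Bornology.IsBounded (connectedComponentIn (c '' Set.Icc p q)ᶜ a) := by
  rcases lt_or_ge q p with hpq | hpq
  · rw [Set.Icc_eq_empty hpq.not_ge]
    simp only [Set.image_empty, Set.compl_empty, connectedComponentIn_univ,
      PreconnectedSpace.connectedComponent_eq_univ]
    exact NormedSpace.unbounded_univ ℝ ℂ
  have hcpt : IsCompact (c '' Set.Icc p q) := isCompact_Icc.image hc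
  -- Clamping the parameter to [p, q] gives a curve on all of ℝ, where logarithms exist.
  set c' : ℝ → ℂ := fun t => c (Set.projIcc p q hpq t) with hc'
  have hc'c : Continuous c' := by fun_prop
  obtain ⟨l, hl, hlc⟩ := exists_continuous_log (f := fun t => c' t - a) (by fun_prop)
    (fun t h => ha (by rw [← sub_eq_zero.1 h]; exact Set.mem_image_of_mem c (Subtype.coe_prop _)))
  have hcl : Topology.IsClosedEmbedding (fun t : Set.Icc p q => c t) :=
    Continuous.isClosedEmbedding (by fun_prop) (fun x y h => Subtype.ext (hinj x.2 y.2 h))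
  set φ := hcl.isEmbedding.toHomeomorph with hφ
  have hrange : ∀ z ∈ c '' Set.Icc p q, z ∈ Set.range (fun t : Set.Icc p q => c t) := by
    rintro z ⟨t, ht, rfl⟩
    exact ⟨⟨t, ht⟩, rfl⟩
  -- Injectivity lets the logarithm descend from the parameter to the arc itself; Tietze extends it
  -- to ℂ.
  obtain ⟨G, hG⟩ := ContinuousMap.exists_restrict_eq hcl.isClosed_range
    (⟨fun z => l (φ.symm z), by fun_prop⟩ : C(Set.range (fun t : Set.Icc p q => c t), ℂ))
  refine not_isBounded_connectedComponentIn_of_log hcpt ha (g := G) (by fun_prop) ?_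
  rintro _ ⟨t, ht, rfl⟩
  have h1 := DFunLike.congr_fun hG (φ ⟨t, ht⟩)
  simp only [ContinuousMap.restrict_apply, ContinuousMap.coe_mk, Homeomorph.symm_apply_apply] at h1
  have h2 : ((φ ⟨t, ht⟩ : Set.range (fun t : Set.Icc p q => c t)) : ℂ) = c t := rfl
  rw [h2] at h1
  rw [h1, hlc]
  simp [hc', Set.projIcc_of_mem hpq ht]

/-! ### Parity as a function of the base point. -/

theorem HasAntiperiodicSqrt.inv {f : ℝ → ℂ} (h0 : ∀ t, f t ≠ 0) (hf : HasAntiperiodicSqrt f) :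
    HasAntiperiodicSqrt fun t => (f t)⁻¹ := by
  obtain ⟨s, hs, hsf, hsa⟩ := hf
  have hs0 : ∀ t, s t ≠ 0 := fun t h => h0 t (by rw [← hsf, h]; simp)
  exact ⟨fun t => (s t)⁻¹, hs.inv₀ hs0, fun t => by rw [inv_pow, hsf],
    fun t => by simp only [hsa, inv_neg]⟩

theorem one_add_mem_slitPlane {z : ℂ} (hz : ‖z‖ < 1) : 1 + z ∈ Complex.slitPlane :=
  Complex.mem_slitPlane_of_norm_lt_one hz

theorem exists_mem_Ico_of_periodic {X : Type*} {c : ℝ → X} (hper : ∀ t, c (t + 1) = c t)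
    (p t : ℝ) : ∃ u ∈ Set.Ico p (p + 1), c t = c u :=
  (show Function.Periodic c 1 from hper).exists_mem_Ico one_pos t p

theorem isCompact_range_of_periodic {c : ℝ → ℂ} (hc : Continuous c)
    (hper : ∀ t, c (t + 1) = c t) : IsCompact (Set.range c) := by
  have : Set.range c = c '' Set.Icc 0 (0 + 1) := by
    apply subset_antisymm
    · rintro _ ⟨t, rfl⟩
      obtain ⟨u, hu, h⟩ := exists_mem_Ico_of_periodic hper 0 t
      exact ⟨u, Set.Ico_subset_Icc_self hu, h.symm⟩
    · exact Set.image_subset_range _ _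
  rw [this]
  exact isCompact_Icc.image hc

/-- The parity of the winding number is locally constant off the curve. -/
theorem hasPeriodicSqrt_sub_div_sub {c : ℝ → ℂ} (hc : Continuous c)
    (hper : ∀ t, c (t + 1) = c t) {x : ℂ} (hx : x ∉ Set.range c) :
    ∀ᶠ y in nhds x, HasPeriodicSqrt fun t => (c t - y) / (c t - x) := by
  have hcl := (isCompact_range_of_periodic hc hper).isClosed
  obtain ⟨ρ, hρ, hball⟩ := Metric.isOpen_iff.1 hcl.isOpen_compl x hx
  have h0 : ∀ t, c t - x ≠ 0 := fun t h => hx ⟨t, sub_eq_zero.1 h⟩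
  filter_upwards [Metric.ball_mem_nhds x hρ] with y hy
  refine hasPeriodicSqrt_of_mem_slitPlane ((by fun_prop : Continuous fun t => c t - y).div
    (by fun_prop) h0) (fun t => ?_) (fun t => by simp only [hper])
  have h1 : (c t - y) / (c t - x) = 1 + (x - y) / (c t - x) := by
    field_simp [h0 t]
    ring
  rw [h1]
  refine one_add_mem_slitPlane ?_
  rw [norm_div, div_lt_one (norm_pos_iff.2 (h0 t))]
  have h2 : ρ ≤ ‖c t - x‖ := by
    by_contra h
    exact hball (show c t ∈ Metric.ball x ρ by rw [Metric.mem_ball, dist_eq_norm]; linarith)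
      ⟨t, rfl⟩
  rw [Metric.mem_ball, dist_comm, dist_eq_norm] at hy
  linarith

/-- Even and odd parity are both open conditions off the curve and exclude each other, so a
preconnected set cannot carry both. -/
theorem hasPeriodicSqrt_sub_of_isPreconnected {c : ℝ → ℂ} (hc : Continuous c)
    (hper : ∀ t, c (t + 1) = c t) {S : Set ℂ} (hS : IsPreconnected S) (hSc : S ⊆ (Set.range c)ᶜ)
    {x y : ℂ} (hx : x ∈ S) (hy : y ∈ S) (hp : HasPeriodicSqrt fun t => c t - x) :
    HasPeriodicSqrt fun t => c t - y := by
  have h0 : ∀ z ∈ S, ∀ t, c t - z ≠ 0 := fun z hz t h => hSc hz ⟨t, sub_eq_zero.1 h⟩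
  have hdich : ∀ z ∈ S, HasPeriodicSqrt (fun t => c t - z) ∨
      HasAntiperiodicSqrt (fun t => c t - z) := fun z hz =>
    hasPeriodicSqrt_or_hasAntiperiodicSqrt (by fun_prop) (h0 z hz) (fun t => by simp only [hper])
  have hmul : ∀ u v t, u ∈ S → (c t - u) * ((c t - v) / (c t - u)) = c t - v :=
    fun u v t hu => mul_div_cancel₀ _ (h0 u hu t)
  by_contra hny
  obtain ⟨z, hzS, hz1, hz2⟩ := hS
    (interior {z | HasPeriodicSqrt fun t => c t - z})
    (interior {z | HasAntiperiodicSqrt fun t => c t - z}) isOpen_interior isOpen_interior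
    (fun z hz => by
      rcases hdich z hz with h | h
      · refine Or.inl (mem_interior_iff_mem_nhds.2 ?_)
        filter_upwards [hasPeriodicSqrt_sub_div_sub hc hper (hSc hz)] with w hw
        simpa only [Set.mem_ofPred_eq, hmul z w _ hz] using h.mul hw
      · refine Or.inr (mem_interior_iff_mem_nhds.2 ?_)
        filter_upwards [hasPeriodicSqrt_sub_div_sub hc hper (hSc hz)] with w hw
        simpa only [Set.mem_ofPred_eq, hmul z w _ hz] using h.mul hw)
    ⟨x, hx, by
      refine mem_interior_iff_mem_nhds.2 ?_
      filter_upwards [hasPeriodicSqrt_sub_div_sub hc hper (hSc hx)] with w hw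
      simpa only [Set.mem_ofPred_eq, hmul x w _ hx] using hp.mul hw⟩
    ⟨y, hy, by
      refine mem_interior_iff_mem_nhds.2 ?_
      filter_upwards [hasPeriodicSqrt_sub_div_sub hc hper (hSc hy)] with w hw
      simpa only [Set.mem_ofPred_eq, hmul y w _ hy] using
        ((hdich y hy).resolve_left hny).mul hw⟩
  exact HasPeriodicSqrt.not_hasAntiperiodicSqrt (h0 z hzS)
    (interior_subset hz1 : _) (interior_subset hz2 : _)

/-- Otherwise the interior of `u` and the complement of its closure would disconnect `S`. -/
theorem IsPreconnected.exists_mem_frontier {X : Type*} [TopologicalSpace X] {S u : Set X}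
    (hS : IsPreconnected S) {x y : X} (hx : x ∈ S) (hxu : x ∈ interior u) (hy : y ∈ S)
    (hyu : y ∉ u) : ∃ p ∈ S, p ∈ frontier u := by
  by_contra! hcon
  obtain ⟨z, -, hz1, hz2⟩ := hS (interior u) (closure u)ᶜ isOpen_interior
    isClosed_closure.isOpen_compl
    (fun z hz => by
      by_cases h : z ∈ closure u
      · by_contra h'
        exact hcon z hz ⟨h, fun h2 => h' (Or.inl h2)⟩
      · exact Or.inr h)
    ⟨x, hx, hxu⟩
    ⟨y, hy, fun h => hcon y hy ⟨h, fun h2 => hyu (interior_subset h2)⟩⟩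
  exact hz2 (subset_closure (interior_subset hz1))

/-! ### Crossing a loop through a short transverse arc. -/

/-- A simple closed curve, parametrized with period `1`, that crosses every vertical line at most
once for parameters in `[-δ, δ]`. -/
structure IsTransverseLoop (c : ℝ → ℂ) (δ : ℝ) : Prop where
  cont : Continuous c
  per : ∀ t, c (t + 1) = c t
  inj : ∀ s t, |s - t| < 1 → c s = c t → s = t
  pos : 0 < δ
  lt_half : δ < 1 / 2
  mono : StrictMonoOn (fun t => (c t).re) (Set.Icc (-δ) δ)

namespace IsTransverseLoop

variable {c : ℝ → ℂ} {δ : ℝ}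

theorem exists_param (h : IsTransverseLoop c δ) (t : ℝ) :
    ∃ u ∈ Set.Ico (-δ) (1 - δ), c t = c u := by
  obtain ⟨u, hu, e⟩ := exists_mem_Ico_of_periodic h.per (-δ) t
  exact ⟨u, ⟨hu.1, by linarith [hu.2]⟩, e⟩

theorem disjoint_arcs (h : IsTransverseLoop c δ) {η : ℝ} (hη : η < δ) :
    Disjoint (c '' Set.Icc (-η) η) (c '' Set.Icc δ (1 - δ)) := by
  rw [Set.disjoint_left]
  rintro _ ⟨s, hs, rfl⟩ ⟨t, ht, e⟩
  have hp := h.pos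
  have hl := h.lt_half
  rcases ht.2.eq_or_lt with h1 | h1
  · have : c t = c (-δ) := by
      rw [← h.per (-δ), h1]; congr 1; ring
    have e2 := h.inj (-δ) s (by rw [abs_lt]; constructor <;> linarith [hs.1, hs.2])
      (this.symm.trans e)
    linarith [hs.1]
  · have e2 := h.inj t s (by rw [abs_lt]; constructor <;> linarith [hs.1, hs.2, ht.1]) e
    linarith [hs.2, ht.1]

/-- The vertical translates of the small arc by small amounts do not meet the curve. -/
theorem exists_vertical (h : IsTransverseLoop c δ) {η : ℝ} (hη : η < δ) :
    ∃ r > 0, (∀ t ∈ Set.Icc (-η) η, ∀ u ∈ Set.Icc δ (1 - δ), r ≤ ‖c u - c t‖) ∧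
      ∀ t ∈ Set.Icc (-η) η, ∀ s : ℝ, s ≠ 0 → |s| < r → c t + s * Complex.I ∉ Set.range c := by
  obtain ⟨r, hr, hd⟩ := (isCompact_Icc.image h.cont).exists_thickening_subset_open
    ((isCompact_Icc.image h.cont).isClosed.isOpen_compl)
    (Set.subset_compl_iff_disjoint_right.2 (h.disjoint_arcs hη))
  have hfar : ∀ t ∈ Set.Icc (-η) η, ∀ u ∈ Set.Icc δ (1 - δ), r ≤ ‖c u - c t‖ := by
    intro t ht u hu
    by_contra hlt
    refine hd (Metric.mem_thickening_iff.2 ⟨c t, ⟨t, ht, rfl⟩, ?_⟩) ⟨u, hu, rfl⟩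
    rw [dist_eq_norm]
    linarith
  refine ⟨r, hr, hfar, fun t ht s hs0 hs => ?_⟩
  rintro ⟨v, hv⟩
  obtain ⟨u, hu, e⟩ := h.exists_param v
  rw [e] at hv
  rcases le_or_gt δ u with h1 | h1
  · have := hfar t ht u ⟨h1, hu.2.le⟩
    rw [hv, add_sub_cancel_left, norm_mul, Complex.norm_I, Complex.norm_real, Real.norm_eq_abs,
      mul_one] at this
    linarith
  · have h2 : (c u).re = (c t).re := by rw [hv]; simp
    have h3 : u = t := h.mono.injOn ⟨hu.1, h1.le⟩ ⟨by linarith [ht.1], by linarith [ht.2]⟩ h2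
    rw [h3] at hv
    have := congrArg Complex.im hv
    simp at this
    exact hs0 this

/-- Crossing the curve changes the parity of the winding number. -/
theorem hasAntiperiodicSqrt_ratio (h : IsTransverseLoop c δ) {ε : ℝ} (hε : 0 < ε)
    (hfar : ∀ u ∈ Set.Icc δ (1 - δ), 3 * ε < ‖c u - c 0‖)
    (h1 : c 0 + ε * Complex.I ∉ Set.range c) (h2 : c 0 - ε * Complex.I ∉ Set.range c) :
    HasAntiperiodicSqrt fun t => (c t - (c 0 - ε * Complex.I)) / (c t - (c 0 + ε * Complex.I)) := by
  have hδ := h.pos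
  have hδ2 := h.lt_half
  have hc := h.cont
  have hn1 : ∀ t, c t - (c 0 + ε * Complex.I) ≠ 0 := fun t e => h1 ⟨t, sub_eq_zero.1 e⟩
  have hn2 : ∀ t, c t - (c 0 - ε * Complex.I) ≠ 0 := fun t e => h2 ⟨t, sub_eq_zero.1 e⟩
  set q : ℝ → ℂ := fun t => (c t - (c 0 - ε * Complex.I)) / (c t - (c 0 + ε * Complex.I)) with hq
  have hqc : Continuous q := (by fun_prop : Continuous fun t => c t - (c 0 - ε * Complex.I)).div
    (by fun_prop) hn1
  have hq0 : ∀ t, q t ≠ 0 := fun t => div_ne_zero (hn2 t) (hn1 t)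
  have hqp : ∀ t, q (t + 1) = q t := fun t => by simp only [hq, h.per]
  refine (hasPeriodicSqrt_or_hasAntiperiodicSqrt hqc hq0 hqp).resolve_left ?_
  rintro ⟨s, hs, hsq, hsp⟩
  -- The imaginary part of q has the sign of Re (c t - c 0), which transversality controls on the
  -- short arc.
  have him : ∀ t, (q t).im =
      2 * ε * (c t - c 0).re / Complex.normSq (c t - (c 0 + ε * Complex.I)) := by
    intro t
    simp only [hq, Complex.div_im]
    rw [← sub_div]
    congr 1
    simp only [Complex.sub_re, Complex.sub_im, Complex.add_re, Complex.add_im, Complex.mul_re,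
      Complex.mul_im, Complex.ofReal_re, Complex.ofReal_im, Complex.I_re, Complex.I_im]
    ring
  have hN : ∀ t, 0 < Complex.normSq (c t - (c 0 + ε * Complex.I)) :=
    fun t => Complex.normSq_pos.2 (hn1 t)
  have him_pos : ∀ t ∈ Set.Icc (-δ) δ, 0 < t → 0 < (q t).im := by
    intro t ht ht0
    rw [him]
    have := h.mono ⟨by linarith, hδ.le⟩ ht ht0
    refine div_pos (mul_pos (by positivity) ?_) (hN t)
    simpa using this
  have him_neg : ∀ t ∈ Set.Icc (-δ) δ, t < 0 → (q t).im < 0 := by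
    intro t ht ht0
    rw [him]
    have := h.mono ht ⟨by linarith, hδ.le⟩ ht0
    refine div_neg_of_neg_of_pos (mul_neg_of_pos_of_neg (by positivity) ?_) (hN t)
    simpa using this
  -- The factor 3 in `hfar` leaves a denominator of norm above 2ε, so on the long arc q stays within
  -- distance 1 of 1.
  have hslit1 : ∀ t ∈ Set.Icc δ (1 - δ), q t ∈ Complex.slitPlane := by
    intro t ht
    have e : q t = 1 + 2 * ε * Complex.I / (c t - (c 0 + ε * Complex.I)) := by
      simp only [hq]
      rw [one_add_div (hn1 t)]
      congr 1
      ring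
    rw [e]
    refine one_add_mem_slitPlane ?_
    rw [norm_div, div_lt_one (norm_pos_iff.2 (hn1 t))]
    have h3 := hfar t ht
    have h4 : ‖c t - c 0‖ ≤ ‖c t - (c 0 + ε * Complex.I)‖ + ‖(ε * Complex.I : ℂ)‖ := by
      refine le_of_eq_of_le (congrArg norm ?_) (norm_add_le _ _)
      ring
    have h5 : ‖(ε * Complex.I : ℂ)‖ = ε := by simp [abs_of_pos hε]
    have h6 : ‖(2 * ε * Complex.I : ℂ)‖ = 2 * ε := by simp [abs_of_pos hε]
    rw [h6]
    linarith
  have hslit2 : ∀ t ∈ Set.Icc (-δ) δ, -q t ∈ Complex.slitPlane := by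
    intro t ht
    rcases lt_trichotomy t 0 with ht0 | rfl | ht0
    · exact Complex.mem_slitPlane_iff.2 (Or.inr (by
        rw [Complex.neg_im]; linarith [him_neg t ht ht0]))
    · have : -q 0 = 1 := by
        simp only [hq]
        have : (ε : ℂ) ≠ 0 := by exact_mod_cast hε.ne'
        field_simp
        simp
      rw [this]
      exact Complex.one_mem_slitPlane
    · exact Complex.mem_slitPlane_iff.2 (Or.inr (by
        rw [Complex.neg_im]; linarith [him_pos t ht ht0]))
  -- On the short arc q passes through -1, so the branch used there is i times the principal root of
  -- -q. Its real part has opposite signs at -δ and δ, whereas the principal root of q has positive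
  -- real part at both ends of the long arc. A periodic root would have to equal each of these up to
  -- sign, which is impossible.
  set k : ℝ → ℂ := fun t => Complex.I * principalSqrt (-q t) with hk
  have hkq : ∀ t, k t ^ 2 = q t := fun t => by
    simp only [hk, mul_pow, Complex.I_sq, principalSqrt_sq (neg_ne_zero.2 (hq0 t))]
    ring
  have hk0 : ∀ t, k t ≠ 0 := fun t e => hq0 t (by rw [← hkq, e]; simp)
  have hp0 : ∀ t, principalSqrt (q t) ≠ 0 := fun t => Complex.exp_ne_zero _
  have hkδ : 0 < (k δ).re := by
    have := (principalSqrt_im_sign (z := -q δ)).2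
      (by rw [Complex.neg_im]; linarith [him_pos δ ⟨by linarith, le_rfl⟩ hδ])
    simp only [hk, Complex.mul_re, Complex.I_re, Complex.I_im]
    linarith
  have hkδ' : (k (-δ)).re < 0 := by
    have := (principalSqrt_im_sign (z := -q (-δ))).1
      (by rw [Complex.neg_im]; linarith [him_neg (-δ) ⟨le_rfl, by linarith⟩ (by linarith)])
    simp only [hk, Complex.mul_re, Complex.I_re, Complex.I_im]
    linarith
  have hpδ : 0 < (principalSqrt (q δ)).re :=
    principalSqrt_re_pos (hslit1 δ ⟨le_rfl, by linarith⟩)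
  have hpδ' : 0 < (principalSqrt (q (1 - δ))).re :=
    principalSqrt_re_pos (hslit1 (1 - δ) ⟨by linarith, le_rfl⟩)
  have hs1 : s (1 - δ) = s (-δ) := by
    rw [← hsp (-δ)]; congr 1; ring
  have c1 := eqOn_or_eqOn_neg_of_sq_eq (S := Set.Icc δ (1 - δ)) isPreconnected_Icc
    hs.continuousOn (continuousOn_principalSqrt.comp hqc.continuousOn hslit1)
    (fun t _ => by simp only [Function.comp, hsq, principalSqrt_sq (hq0 t)]) (fun t _ => hp0 t)
  have c2 := eqOn_or_eqOn_neg_of_sq_eq (S := Set.Icc (-δ) δ) isPreconnected_Icc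
    hs.continuousOn (g := k) (continuousOn_const.mul
      (continuousOn_principalSqrt.comp hqc.neg.continuousOn hslit2))
    (fun t _ => by rw [hsq, hkq]) (fun t _ => hk0 t)
  have m1 : δ ∈ Set.Icc δ (1 - δ) := ⟨le_rfl, by linarith⟩
  have m2 : 1 - δ ∈ Set.Icc δ (1 - δ) := ⟨by linarith, le_rfl⟩
  have m3 : δ ∈ Set.Icc (-δ) δ := ⟨by linarith, le_rfl⟩
  have m4 : -δ ∈ Set.Icc (-δ) δ := ⟨le_rfl, by linarith⟩
  rcases c1 with c1 | c1 <;> rcases c2 with c2 | c2 <;>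
  · have e1 := congrArg Complex.re (c1 m1)
    have e2 := congrArg Complex.re (c1 m2)
    have e3 := congrArg Complex.re (c2 m3)
    have e4 := congrArg Complex.re (c2 m4)
    rw [hs1] at e2
    simp only [Function.comp, Pi.neg_apply, Complex.neg_re] at e1 e2 e3 e4
    linarith

/-- The set of points above (`σ = 1`) or below (`σ = -1`) the small arc. -/
def side (c : ℝ → ℂ) (η r σ : ℝ) : Set ℂ :=
  (fun x : ℝ × ℝ => c x.1 + ((σ * x.2 : ℝ) : ℂ) * Complex.I) '' (Set.Ioo (-η) η ×ˢ Set.Ioo 0 r)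

theorem isPreconnected_side (hc : Continuous c) (η r σ : ℝ) : IsPreconnected (side c η r σ) :=
  (isPreconnected_Ioo.prod isPreconnected_Ioo).image _ (by fun_prop)

/-- By the intermediate value theorem the vertical line through z meets the short arc near c t. The
sign of the height difference selects the side, and height zero would put z on the curve. -/
theorem mem_side_of_near (h : IsTransverseLoop c δ) {η r : ℝ} (hη : η < δ) (hr : 0 < r) {t : ℝ}
    (ht : t ∈ Set.Ioo (-η) η) :
    ∀ᶠ z in nhds (c t), z ∉ Set.range c → z ∈ side c η r 1 ∨ z ∈ side c η r (-1) := by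
  have hc := h.cont
  obtain ⟨ρ, hρ, hcρ⟩ := Metric.continuousAt_iff.1 (hc.continuousAt (x := t)) (r / 2)
    (by linarith)
  obtain ⟨κ, hκ, hκ1, hκ2, hκ3⟩ : ∃ κ > 0, κ < ρ ∧ -η < t - κ ∧ t + κ < η := by
    refine ⟨min (ρ / 2) (min ((t + η) / 2) ((η - t) / 2)), ?_, ?_, ?_, ?_⟩
    · have := ht.1; have := ht.2
      exact lt_min (by linarith) (lt_min (by linarith) (by linarith))
    · exact (min_le_left _ _).trans_lt (by linarith)
    · have := (min_le_right (ρ / 2) _).trans (min_le_left ((t + η) / 2) ((η - t) / 2))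
      linarith [ht.1]
    · have := (min_le_right (ρ / 2) _).trans (min_le_right ((t + η) / 2) ((η - t) / 2))
      linarith [ht.2]
  have hm1 : (c (t - κ)).re < (c t).re :=
    h.mono ⟨by linarith, by linarith⟩ ⟨by linarith, by linarith⟩ (by linarith)
  have hm2 : (c t).re < (c (t + κ)).re :=
    h.mono ⟨by linarith, by linarith⟩ ⟨by linarith, by linarith⟩ (by linarith)
  filter_upwards [Metric.ball_mem_nhds (c t) (half_pos hr),
    Complex.continuous_re.continuousAt.eventually_const_lt hm1,
    Complex.continuous_re.continuousAt.eventually_lt_const hm2] with z hz hz1 hz2 hzc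
  obtain ⟨u, hu, hue⟩ := intermediate_value_Icc (by linarith : t - κ ≤ t + κ)
    (f := fun t => (c t).re) (by fun_prop) ⟨hz1.le, hz2.le⟩
  simp only at hue
  have hd : |z.im - (c u).im| < r := by
    have h1 : ‖c u - c t‖ < r / 2 := by
      rw [← dist_eq_norm]
      apply hcρ
      rw [Real.dist_eq, abs_lt]
      constructor <;> linarith [hu.1, hu.2]
    rw [Metric.mem_ball, dist_eq_norm] at hz
    have h2 : ‖z - c u‖ < r := by
      calc ‖z - c u‖ = ‖(z - c t) - (c u - c t)‖ := by congr 1; ring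
        _ ≤ _ := norm_sub_le _ _
        _ < r := by linarith
    have h3 := Complex.abs_im_le_norm (z - c u)
    rw [Complex.sub_im] at h3
    linarith
  have hu' : u ∈ Set.Ioo (-η) η := ⟨by linarith [hu.1], by linarith [hu.2]⟩
  rcases lt_trichotomy (z.im - (c u).im) 0 with h0 | h0 | h0
  · refine Or.inr ⟨(u, -(z.im - (c u).im)), ⟨hu', by simpa using h0, ?_⟩, ?_⟩
    · rwa [abs_of_neg h0] at hd
    · apply Complex.ext <;> simp [hue]
  · exact absurd ⟨u, Complex.ext hue (by linarith)⟩ hzc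
  · refine Or.inl ⟨(u, z.im - (c u).im), ⟨hu', by simpa using h0, ?_⟩, ?_⟩
    · rwa [abs_of_pos h0] at hd
    · apply Complex.ext <;> simp [hue]

/-- A component of the complement of the curve that is a proper part of a component of the
complement of the long arc contains one of the sides of the short arc. -/
theorem side_subset_connectedComponentIn (h : IsTransverseLoop c δ) {η r : ℝ}
    (hη : η < δ) (hr : 0 < r)
    (hside : ∀ σ ∈ ({1, -1} : Set ℝ), side c η r σ ⊆ (Set.range c)ᶜ) {a b : ℂ}
    (ha : a ∉ Set.range c)
    (hb : b ∈ connectedComponentIn (c '' Set.Icc η (1 - η))ᶜ a)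
    (hab : b ∉ connectedComponentIn (Set.range c)ᶜ a) :
    ∃ σ ∈ ({1, -1} : Set ℝ), side c η r σ ⊆ connectedComponentIn (Set.range c)ᶜ a := by
  have hJ : IsClosed (Set.range c) := (isCompact_range_of_periodic h.cont h.per).isClosed
  have haK : a ∉ c '' Set.Icc η (1 - η) := fun h' => ha (Set.image_subset_range _ _ h')
  have haC : a ∈ connectedComponentIn (Set.range c)ᶜ a := mem_connectedComponentIn ha
  -- The component of a has a frontier point p inside the larger component. It lies on the curve but
  -- not on the long arc, hence on the open short arc, where nearby points off the curve belong to a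
  -- side.
  obtain ⟨p, hpW, hpf⟩ := IsPreconnected.exists_mem_frontier
    (isPreconnected_connectedComponentIn (F := (c '' Set.Icc η (1 - η))ᶜ) (x := a))
    (u := connectedComponentIn (Set.range c)ᶜ a) (mem_connectedComponentIn haK)
    (hJ.isOpen_compl.connectedComponentIn.interior_eq.symm ▸ haC) hb hab
  obtain ⟨t, rfl⟩ := frontier_connectedComponentIn_subset hJ a hpf
  have hpK := connectedComponentIn_subset _ _ hpW
  obtain ⟨u, hu, hu2, e⟩ : ∃ u, u ∈ Set.Ico (-η) (1 - η) ∧ u < η ∧ c t = c u := by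
    obtain ⟨u, hu, e⟩ := exists_mem_Ico_of_periodic h.per (-η) t
    refine ⟨u, ⟨hu.1, by linarith [hu.2]⟩, ?_, e⟩
    by_contra hlt
    exact hpK ⟨u, ⟨not_lt.1 hlt, by linarith [hu.2]⟩, e.symm⟩
  have hu1 : -η < u := by
    refine lt_of_le_of_ne hu.1 fun h' => hpK ⟨1 - η, ⟨by linarith [h.lt_half], le_rfl⟩, ?_⟩
    rw [e, ← h', ← h.per (-η)]
    congr 1
    ring
  rw [e] at hpf
  obtain ⟨z, hz, hz2⟩ := (mem_closure_iff_frequently.1 hpf.1).and_eventually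
    (h.mem_side_of_near hη hr ⟨hu1, hu2⟩) |>.exists
  have hz3 := hz2 (connectedComponentIn_subset _ _ hz)
  have key : ∀ σ ∈ ({1, -1} : Set ℝ), z ∈ side c η r σ →
      side c η r σ ⊆ connectedComponentIn (Set.range c)ᶜ a := by
    intro σ hσ hzσ
    rw [connectedComponentIn_eq hz]
    exact (isPreconnected_side h.cont η r σ).subset_connectedComponentIn hzσ (hside σ hσ)
  rcases hz3 with hz3 | hz3
  · exact ⟨1, by simp, key 1 (by simp) hz3⟩
  · exact ⟨-1, by simp, key (-1) (by simp) hz3⟩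

/-- The winding number of the curve about a point in a bounded component of its complement is
odd. -/
theorem hasAntiperiodicSqrt_sub (h : IsTransverseLoop c δ) {a : ℂ} (ha : a ∉ Set.range c)
    (hb : Bornology.IsBounded (connectedComponentIn (Set.range c)ᶜ a)) :
    HasAntiperiodicSqrt fun t => c t - a := by
  have hc := h.cont
  have hδ := h.pos
  have hδ2 := h.lt_half
  set η := δ / 2 with hη
  have hηδ : η < δ := by linarith
  have hη0 : 0 < η := by linarith
  obtain ⟨r, hr, hfar, hvert⟩ := h.exists_vertical hηδ
  have hside : ∀ σ ∈ ({1, -1} : Set ℝ), side c η r σ ⊆ (Set.range c)ᶜ := by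
    rintro σ hσ _ ⟨⟨t, s⟩, ⟨ht, hs⟩, rfl⟩
    refine hvert t (Set.Ioo_subset_Icc_self ht) _ ?_ ?_
    · rcases hσ with rfl | rfl <;> simp [hs.1.ne']
    · rcases hσ with rfl | rfl <;> simp [abs_of_pos hs.1, hs.2]
  have hJ := isCompact_range_of_periodic hc h.per
  have haK : a ∉ c '' Set.Icc η (1 - η) := fun h' => ha (Set.image_subset_range _ _ h')
  have haC : a ∈ connectedComponentIn (Set.range c)ᶜ a := mem_connectedComponentIn ha
  have hunb := not_isBounded_connectedComponentIn_compl_arc hc (p := η) (q := 1 - η)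
    (fun s hs t ht e => h.inj s t
      (by rw [abs_lt]; constructor <;> linarith [hs.1, hs.2, ht.1, ht.2]) e) haK
  obtain ⟨M, hM0, hM⟩ := (hJ.isBounded.union hb).subset_ball_lt 0 0
  -- With only the long arc removed, a can be joined to a point b beyond the curve and beyond the
  -- bounded component of a. The components of a and b in the complement of the full curve are thus
  -- distinct, and each contains a side of the short arc.
  obtain ⟨b, hbW, hbM⟩ : ∃ b ∈ connectedComponentIn (c '' Set.Icc η (1 - η))ᶜ a, M ≤ ‖b‖ := by
    by_contra hcon
    push Not at hcon
    exact hunb (Metric.isBounded_ball.subset fun z hz => mem_ball_zero_iff.2 (hcon z hz))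
  have hbn : b ∉ Set.range c ∪ connectedComponentIn (Set.range c)ᶜ a := fun h' =>
    absurd (mem_ball_zero_iff.1 (hM h')) (not_lt.2 hbM)
  have hbJ : b ∉ Set.range c := fun h' => hbn (Or.inl h')
  have hbC : b ∉ connectedComponentIn (Set.range c)ᶜ a := fun h' => hbn (Or.inr h')
  have haCb : a ∉ connectedComponentIn (Set.range c)ᶜ b := fun h' =>
    hbC (by rw [← connectedComponentIn_eq h']; exact mem_connectedComponentIn hbJ)
  obtain ⟨σ, hσ, hσa⟩ := h.side_subset_connectedComponentIn hηδ hr hside ha hbW hbC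
  obtain ⟨τ, hτ, hτb⟩ := h.side_subset_connectedComponentIn hηδ hr hside hbJ
    (by rw [← connectedComponentIn_eq hbW]; exact mem_connectedComponentIn haK) haCb
  set ε := r / 4 with hε
  have hε0 : 0 < ε := by linarith
  have hmem : ∀ σ, c 0 + ((σ * ε : ℝ) : ℂ) * Complex.I ∈ side c η r σ := fun σ =>
    ⟨(0, ε), ⟨⟨by linarith, hη0⟩, hε0, by linarith⟩, rfl⟩
  have hστ : σ ≠ τ := by
    rintro rfl
    have h1 := connectedComponentIn_eq (hσa (hmem σ))
    have h2 := connectedComponentIn_eq (hτb (hmem σ))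
    exact haCb (by rw [h2, ← h1]; exact haC)
  -- Far out the parity is even: c - b = -b (1 - c/b) with |c/b| < 1.
  have hpb : HasPeriodicSqrt fun t => c t - b := by
    have hb0 : b ≠ 0 := fun h' => by rw [h', norm_zero] at hbM; linarith
    have : HasPeriodicSqrt fun t => 1 + -(c t / b) := by
      refine hasPeriodicSqrt_of_mem_slitPlane (by fun_prop) (fun t => one_add_mem_slitPlane ?_)
        (fun t => by simp only [h.per])
      rw [norm_neg, norm_div, div_lt_one (norm_pos_iff.2 hb0)]
      exact (mem_ball_zero_iff.1 (hM (Or.inl ⟨t, rfl⟩))).trans_le hbM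
    convert (hasPeriodicSqrt_const (-b)).mul this using 2 with t
    field_simp
    ring
  have hpτ := hasPeriodicSqrt_sub_of_isPreconnected hc h.per isPreconnected_connectedComponentIn
    (connectedComponentIn_subset _ _) (mem_connectedComponentIn hbJ) (hτb (hmem τ)) hpb
  have hn : ∀ σ ∈ ({1, -1} : Set ℝ), ∀ t, c t - (c 0 + ((σ * ε : ℝ) : ℂ) * Complex.I) ≠ 0 :=
    fun σ hσ t e => hside σ hσ (hmem σ) ⟨t, sub_eq_zero.1 e⟩
  have hratio := h.hasAntiperiodicSqrt_ratio hε0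
    (fun u hu => by linarith [hfar 0 ⟨by linarith, hη0.le⟩ u hu])
    (by simpa using hside 1 (by simp) (hmem 1))
    (by simpa [sub_eq_add_neg] using hside (-1) (by simp) (hmem (-1)))
  have hn1 : ∀ t, c t - (c 0 + ε * Complex.I) ≠ 0 := fun t => by
    simpa using hn 1 (by simp) t
  have hn2 : ∀ t, c t - (c 0 - ε * Complex.I) ≠ 0 := fun t => by
    simpa [sub_eq_add_neg] using hn (-1) (by simp) t
  have hap : HasAntiperiodicSqrt fun t => c t - (c 0 + ((σ * ε : ℝ) : ℂ) * Complex.I) := by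
    rcases hσ with rfl | rfl <;> rcases hτ with rfl | rfl
    · exact absurd rfl hστ
    · convert (hratio.inv fun t => div_ne_zero (hn2 t) (hn1 t)).mul hpτ using 2 with t
      have := hn1 t
      have := hn2 t
      push_cast
      rw [inv_div, one_mul, neg_one_mul, neg_mul, ← sub_eq_add_neg]
      field_simp
    · convert hratio.mul hpτ using 2 with t
      have := hn1 t
      push_cast
      rw [one_mul, neg_one_mul, neg_mul, ← sub_eq_add_neg]
      field_simp
    · exact absurd rfl hστ
  refine (hasPeriodicSqrt_or_hasAntiperiodicSqrt (by fun_prop)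
    (fun t e => ha ⟨t, sub_eq_zero.1 e⟩) (fun t => by simp only [h.per])).resolve_left fun hpa => ?_
  exact (hasPeriodicSqrt_sub_of_isPreconnected hc h.per isPreconnected_connectedComponentIn
    (connectedComponentIn_subset _ _) haC (hσa (hmem σ)) hpa).not_hasAntiperiodicSqrt
      (hn σ hσ) hap

end IsTransverseLoop

/-! ### From transverse loops to C¹ Jordan curves. -/

/-- The winding number of a `C¹` Jordan curve about a point that it encircles is odd. -/
theorem hasAntiperiodicSqrt_sub_of_jordan {c : ℝ → ℂ} (hc : ContDiff ℝ 1 c)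
    (hper : ∀ t, c (t + 1) = c t) (hinj : Set.InjOn c (Set.Ico 0 1)) {a : ℂ}
    (ha : a ∉ Set.range c)
    (hb : Bornology.IsBounded (connectedComponentIn (Set.range c)ᶜ a)) :
    HasAntiperiodicSqrt fun t => c t - a := by
  have hinj' : ∀ s t, |s - t| < 1 → c s = c t → s = t := by
    intro s t hst e
    have hfr : ∀ x : ℝ, c (Int.fract x) = c x := fun x => by
      have := (show Function.Periodic c 1 from hper).sub_int_mul_eq ⌊x⌋ (x := x)
      rwa [mul_one] at this
    have h1 : Int.fract s = Int.fract t :=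
      hinj ⟨Int.fract_nonneg s, Int.fract_lt_one s⟩ ⟨Int.fract_nonneg t, Int.fract_lt_one t⟩
        (by rw [hfr, hfr, e])
    have h2 : s - t = ((⌊s⌋ - ⌊t⌋ : ℤ) : ℝ) := by
      have := Int.floor_add_fract s
      have := Int.floor_add_fract t
      push_cast
      linarith
    rw [h2] at hst
    have h3 : ⌊s⌋ - ⌊t⌋ = 0 := by
      rw [← Int.abs_lt_one_iff]
      exact_mod_cast hst
    rw [h3] at h2
    simpa [sub_eq_zero] using h2
  obtain ⟨t₀, ht₀⟩ : ∃ t₀, deriv c t₀ ≠ 0 := by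
    by_contra! hcon
    have := is_const_of_deriv_eq_zero (hc.differentiable one_ne_zero) hcon 0 (1 / 2)
    have := hinj ⟨le_rfl, one_pos⟩ ⟨by norm_num, by norm_num⟩ this
    norm_num at this
  -- Multiplying by the conjugate of a nonzero velocity makes that velocity positive real, so the
  -- real part increases strictly near t₀.
  set u : ℂ := (starRingEnd ℂ) (deriv c t₀) with hu
  have hu0 : u ≠ 0 := by simpa [hu] using ht₀
  set d : ℝ → ℂ := fun t => u * c (t + t₀) with hd
  have hdc : Continuous d := by have := hc.continuous; fun_prop
  have hder : ∀ t, HasDerivAt (fun t => (d t).re) (u * deriv c (t + t₀)).re t := by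
    intro t
    have h1 : HasDerivAt (fun t => c (t + t₀)) (deriv c (t + t₀)) t :=
      ((hc.differentiable one_ne_zero _).hasDerivAt).comp_add_const t t₀
    exact Complex.reCLM.hasFDerivAt.comp_hasDerivAt t (h1.const_mul u)
  have hdcont : Continuous fun t => (u * deriv c (t + t₀)).re := by
    have := hc.continuous_deriv le_rfl
    fun_prop
  have hpos : 0 < (u * deriv c (0 + t₀)).re := by
    rw [zero_add, hu, ← Complex.normSq_eq_conj_mul_self, Complex.ofReal_re]
    exact Complex.normSq_pos.2 ht₀
  obtain ⟨ρ, hρ, hρpos⟩ := Metric.eventually_nhds_iff.1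
    (hdcont.continuousAt.eventually_const_lt hpos)
  have hT : IsTransverseLoop d (min (ρ / 2) (1 / 4)) := by
    have hm1 := min_le_left (ρ / 2) (1 / 4)
    have hm2 := min_le_right (ρ / 2) (1 / 4)
    refine ⟨hdc, fun t => ?_, fun s t hst e => ?_, lt_min (by linarith) (by norm_num),
      by linarith, ?_⟩
    · simp only [hd]
      rw [← hper (t + t₀)]
      congr 2
      ring
    · have := hinj' (s + t₀) (t + t₀) (by simpa using hst) (mul_left_cancel₀ hu0 e)
      linarith
    · refine strictMonoOn_of_deriv_pos (convex_Icc _ _) (by fun_prop) fun t ht => ?_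
      rw [interior_Icc] at ht
      rw [(hder t).deriv]
      apply hρpos
      rw [Real.dist_eq, sub_zero, abs_lt]
      constructor <;> linarith [ht.1, ht.2]
  set φ : ℂ ≃ₜ ℂ := Homeomorph.mulLeft₀ u hu0 with hφ
  have hφa : ∀ z, φ z = u * z := fun z => rfl
  have hrange : Set.range d = φ '' Set.range c := by
    apply subset_antisymm
    · rintro _ ⟨t, rfl⟩
      exact ⟨_, ⟨t + t₀, rfl⟩, rfl⟩
    · rintro _ ⟨_, ⟨t, rfl⟩, rfl⟩
      exact ⟨t - t₀, by simp [hd, hφa]⟩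
  have hcomp : connectedComponentIn (Set.range d)ᶜ (u * a) =
      φ '' connectedComponentIn (Set.range c)ᶜ a := by
    rw [φ.image_connectedComponentIn (Set.mem_compl ha), hrange,
      Set.image_compl_eq φ.bijective, hφa]
  obtain ⟨s, hs, hsd, hsa⟩ := hT.hasAntiperiodicSqrt_sub (a := u * a)
    (by rw [hrange, ← hφa, φ.injective.mem_set_image]; exact ha)
    (by
      rw [hcomp]
      obtain ⟨R, hR⟩ := hb.exists_norm_le
      refine (isBounded_iff_forall_norm_le (E := ℂ)).2 ⟨‖u‖ * R, ?_⟩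
      rintro _ ⟨z, hz, rfl⟩
      rw [hφa, norm_mul]
      exact mul_le_mul_of_nonneg_left (hR z hz) (norm_nonneg _))
  have h1 : HasAntiperiodicSqrt fun t => u * (c t - a) := by
    refine ⟨fun t => s (t - t₀), by fun_prop, fun t => ?_, fun t => ?_⟩
    · rw [hsd]
      simp only [hd, sub_add_cancel]
      ring
    · simp only
      rw [← hsa]
      congr 1
      ring
  convert h1.mul (hasPeriodicSqrt_const u⁻¹) using 2 with t
  field_simp

/-- The version of `hasAntiperiodicSqrt_sub_of_jordan` in linear coordinates on the plane. -/
theorem Encircles.hasAntiperiodicSqrt {γ : ℝ → ℝ × ℝ} (hγ : IsSmoothJordanCurve γ) {ξ : ℝ × ℝ}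
    (h : Encircles γ ξ) (L : (ℝ × ℝ) ≃L[ℝ] ℂ) :
    HasAntiperiodicSqrt fun t => L (γ t - ξ) := by
  have hrange : Set.range (fun t => L (γ t)) = L '' Set.range γ := by
    rw [← Set.range_comp]; rfl
  have key := hasAntiperiodicSqrt_sub_of_jordan (c := fun t => L (γ t)) (a := L ξ)
    (L.contDiff.comp hγ.contDiff) (fun t => by rw [hγ.period.2.1 t])
    (L.injective.comp_injOn hγ.injOn)
    (by rw [hrange, L.injective.mem_set_image]; exact h.1)
    (by
      have hcomp : connectedComponentIn (Set.range fun t => L (γ t))ᶜ (L ξ) =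
          L '' connectedComponentIn (Set.range γ)ᶜ ξ := by
        have := L.toHomeomorph.image_connectedComponentIn (Set.mem_compl h.1)
        simp only [ContinuousLinearEquiv.coe_toHomeomorph] at this
        rw [this, hrange, Set.image_compl_eq L.bijective]
      rw [hcomp]
      exact L.lipschitz.isBounded_image h.2)
  simpa only [map_sub] using key

/-! ### Continuous selections from finite sets. -/

/-- Distinct points of a finite set of complex numbers are uniformly separated. -/
theorem Set.Finite.exists_separation {S : Set ℂ} (hS : S.Finite) :
    ∃ r > 0, ∀ z ∈ S, ∀ w ∈ S, dist z w < 2 * r → z = w := by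
  rcases S.subsingleton_or_nontrivial with h | h
  · exact ⟨1, one_pos, fun z hz w hw _ => h hz hw⟩
  · have hp := hS.infsep_pos_iff_nontrivial.2 h
    refine ⟨S.infsep / 2, by linarith, fun z hz w hw hd => ?_⟩
    by_contra hne
    linarith [Set.infsep_le_dist_of_mem hz hw hne]

/-- Choosing for each point of `S` a nearby point of `T` is injective by separation, hence
surjective by cardinality. So every point of `T` close to w is the one chosen for w. -/
theorem eq_of_dist_lt_of_separated {S T : Set ℂ} (hT : T.Finite) (hcard : T.ncard ≤ S.ncard)
    {r : ℝ} (hsep : ∀ z ∈ S, ∀ w ∈ S, dist z w < 2 * r → z = w)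
    (hnear : ∀ w ∈ S, ∃ z ∈ T, dist z w < r) {z z' w : ℂ} (hw : w ∈ S) (hz : z ∈ T) (hz' : z' ∈ T)
    (hzw : dist z w < r) (hzw' : dist z' w < r) : z = z' := by
  choose φ hφT hφ using hnear
  have hsurj := Set.surj_on_of_inj_on_of_ncard_le (s := S) (t := T) φ hφT
    (fun a b ha hb e => hsep a ha b hb (by
      have h1 := hφ a ha
      have h2 := hφ b hb
      rw [dist_comm] at h1
      rw [← e] at h2
      linarith [dist_triangle a (φ a ha) b])) hcard hT
  have key : ∀ y ∈ T, dist y w < r → y = φ w hw := by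
    intro y hy hyw
    obtain ⟨v, hv, e⟩ := hsurj y hy
    have h1 := hφ v hv
    rw [← e, dist_comm] at h1
    have : v = w := hsep v hv w hw (by linarith [dist_triangle v y w])
    subst this
    exact e
  rw [key z hz hzw, key z' hz' hzw']

/-- A continuous family of finite sets of constant cardinality over a simply connected space has
a continuous selection through any point. -/
theorem exists_continuous_selection {X : Type*} [TopologicalSpace X] [SimplyConnectedSpace X]
    [LocallyPathConnectedSpace X] {G : X → Set ℂ} {m : ℕ} (hfin : ∀ x, (G x).Finite)
    (hcard : ∀ x, (G x).ncard = m)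
    (hcont : ∀ x, ∀ ε > 0, ∀ᶠ y in nhds x,
      (∀ z ∈ G y, ∃ w ∈ G x, dist z w < ε) ∧ ∀ w ∈ G x, ∃ z ∈ G y, dist z w < ε)
    {x₀ : X} {z₀ : ℂ} (hz₀ : z₀ ∈ G x₀) :
    ∃ μ : X → ℂ, Continuous μ ∧ (∀ x, μ x ∈ G x) ∧ μ x₀ = z₀ := by
  classical
  have hm : 0 < m := by
    rw [← hcard x₀]; exact (Set.ncard_pos (hfin x₀)).2 ⟨z₀, hz₀⟩
  have hne : ∀ x, (G x).Nonempty := fun x => (Set.ncard_pos (hfin x)).1 (by rw [hcard]; exact hm)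
  let E := {p : X × ℂ // p.2 ∈ G p.1}
  let f : E → X := fun p => p.1.1
  have hf : Continuous f := by fun_prop
  have hnonempty : Nonempty (X → E) := ⟨fun _ => ⟨(x₀, z₀), hz₀⟩⟩
  have hn' : ∀ x, Nonempty (G x) := fun x => (hne x).to_subtype
  have hf' : ∀ x, Finite (G x) := fun x => (hfin x).to_subtype
  -- The sheets over a neighbourhood of x consist of the points within r of one fixed element of G
  -- x. Separation and constant cardinality make each sheet meet each fibre exactly once.
  have htriv : ∀ x, ∃ e : Bundle.Trivialization (G x) f, x ∈ e.baseSet := by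
    intro x
    obtain ⟨r, hr, hsep⟩ := (hfin x).exists_separation
    let Q : Set X := {y | (∀ z ∈ G y, ∃ w ∈ G x, dist z w < r) ∧
      ∀ w ∈ G x, ∃ z ∈ G y, dist z w < r}
    let V : Set X := interior Q
    have hVm : ∀ y ∈ V, (∀ z ∈ G y, ∃ w ∈ G x, dist z w < r) ∧
      ∀ w ∈ G x, ∃ z ∈ G y, dist z w < r := fun y hy =>
        (interior_subset hy : y ∈ Q)
    refine ⟨IsOpen.trivializationDiscrete (f := f) (fun i : G x => {p : E | f p ∈ V ∧ dist p.1.2 i < r})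
      V
      isOpen_interior (fun i W hW => ?_) (fun i => ?_) (fun i => ?_) ?_ ?_, ?_⟩
    · have hUo : IsOpen {p : E | f p ∈ V ∧ dist p.1.2 i < r} :=
        (isOpen_interior.preimage hf).inter (isOpen_lt
          (f := fun p : E => dist p.1.2 (i : ℂ)) (g := fun _ => r) (by fun_prop) continuous_const)
      refine ⟨fun hWo => (hWo.preimage hf).inter hUo, fun hWo => ?_⟩
      rw [isOpen_iff_mem_nhds]
      intro y hy
      obtain ⟨z, hz, hzi⟩ := (hVm y (hW hy)).2 i i.2
      obtain ⟨O, hO, hOe⟩ := isOpen_induced_iff.1 hWo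
      have hmem : ((y, z) : X × ℂ) ∈ O := by
        have : (⟨(y, z), hz⟩ : E) ∈ Subtype.val ⁻¹' O := by rw [hOe]; exact ⟨hy, hW hy, hzi⟩
        exact this
      obtain ⟨A, hA, B, hB, hAB⟩ := mem_nhds_prod_iff.1 (hO.mem_nhds hmem)
      obtain ⟨ε, hε, hεB⟩ := Metric.mem_nhds_iff.1 hB
      filter_upwards [hA, hcont y ε hε] with y' hy' hy2
      obtain ⟨z', hz', hzz⟩ := hy2.2 z hz
      have : (⟨(y', z'), hz'⟩ : E) ∈ Subtype.val ⁻¹' O := hAB ⟨hy', hεB hzz⟩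
      rw [hOe] at this
      exact this.1
    · rintro ⟨⟨y, z⟩, hz⟩ hzi ⟨⟨y', z'⟩, hz'⟩ hzi' (e : y = y')
      subst e
      have : z = z' := eq_of_dist_lt_of_separated (hfin y) (by rw [hcard, hcard]) hsep
        (hVm y hzi.1).2 i.2 hz hz' hzi.2 hzi'.2
      subst this
      rfl
    · intro y hy
      obtain ⟨z, hz, hzi⟩ := (hVm y hy).2 i i.2
      exact ⟨⟨(y, z), hz⟩, ⟨hy, hzi⟩, rfl⟩
    · intro i j hij
      simp only [Function.onFun, Set.disjoint_left]
      intro p hp hp'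
      refine hij (Subtype.ext (hsep i i.2 j j.2 ?_))
      have h1 : dist p.1.2 i < r := hp.2
      have h2 : dist p.1.2 j < r := hp'.2
      rw [dist_comm] at h1
      linarith [dist_triangle (i : ℂ) p.1.2 j]
    · rintro ⟨⟨y, z⟩, hz⟩ hy
      obtain ⟨w, hw, hzw⟩ := (hVm y hy).1 z hz
      exact Set.mem_iUnion.2 ⟨⟨w, hw⟩, hy, hzw⟩
    · exact mem_interior_iff_mem_nhds.2 (hcont x r hr)
  choose e he using htriv
  have hcov : IsCoveringMap f := IsCoveringMap.mk f (fun x => G x) e he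
  -- A lift of the identity through the covering is a section; simple connectedness provides it.
  obtain ⟨F, ⟨hF0, hF⟩, -⟩ := hcov.existsUnique_continuousMap_lifts (ContinuousMap.id X) x₀
    ⟨(x₀, z₀), hz₀⟩ rfl
  have hE : Continuous fun p : E => p.1.2 := by fun_prop
  refine ⟨fun x => (show E from F x).1.2, hE.comp F.continuous, fun x => ?_, by simp only [hF0]⟩
  have h1 : (show E from F x).1.1 = x := congrFun hF x
  have h2 := (show E from F x).2
  rwa [h1] at h2

/-! ### Transported eigenvectors: lengths, determinant and phases. -/

theorem Matrix.hasDerivAt_det {m : Type*} [Fintype m] [DecidableEq m] {V : ℝ → Matrix m m ℂ}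
    {V' : Matrix m m ℂ} {t : ℝ} (h : ∀ i j, HasDerivAt (fun s => V s i j) (V' i j) t) :
    HasDerivAt (fun s => (V s).det) (∑ j, ((V t).updateCol j fun i => V' i j).det) t := by
  simp only [Matrix.det_apply']
  rw [Finset.sum_comm]
  refine HasDerivAt.fun_sum fun σ _ => ?_
  rw [← Finset.mul_sum]
  refine HasDerivAt.const_mul _ ?_
  convert HasDerivAt.fun_finsetProd (u := Finset.univ) (f := fun j s => V s (σ j) j)
    (f' := fun j => V' (σ j) j) (x := t) (fun j _ => h (σ j) j) using 1
  refine Finset.sum_congr rfl fun j _ => ?_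
  rw [← Finset.mul_prod_erase _ _ (Finset.mem_univ j), smul_eq_mul, mul_comm]
  congr 1
  · refine Finset.prod_congr rfl fun i hi => ?_
    rw [Matrix.updateCol_ne (Finset.ne_of_mem_erase hi)]
  · rw [Matrix.updateCol_self]

/-- Cramer's rule: the left side is an entry of adj(V) V P. Summed over j this turns the derivative
of det V into tr(P) det V. -/
theorem Matrix.det_updateCol_mul {m : Type*} [Fintype m] [DecidableEq m] (V P : Matrix m m ℂ)
    (j : m) : (V.updateCol j fun i => (V * P) i j).det = P j j * V.det := by
  rw [← Matrix.cramer_apply, Matrix.cramer_eq_adjugate_mulVec]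
  have : (fun i => (V * P) i j) = V.mulVec (fun i => P i j) := rfl
  rw [this, Matrix.mulVec_mulVec, Matrix.adjugate_mul, Matrix.smul_mulVec,
    Matrix.one_mulVec, Pi.smul_apply, smul_eq_mul, mul_comm]

namespace IsTransportedEigendecomposition

variable {n : ℕ} {k : ℕ∞} {B V : ℝ → Matrix (Fin n) (Fin n) ℂ} {Lam : Fin n → ℝ → ℂ}

theorem contDiff_entry (hk : 1 ≤ k) (hV : IsTransportedEigendecomposition k B V Lam)
    (i j : Fin n) : ContDiff ℝ 1 fun s => V s i j :=
  (contDiffOn_univ.1 (hV.contDiff_vectors i j)).of_le (by exact_mod_cast hk)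

theorem hasDerivAt_entry (hk : 1 ≤ k) (hV : IsTransportedEigendecomposition k B V Lam)
    (t : ℝ) (i j : Fin n) :
    HasDerivAt (fun s => V s i j) ((V t * logDerivMatrix V t) i j) t := by
  have h1 := ((hV.contDiff_entry hk i j).differentiable one_ne_zero t).hasDerivAt
  rw [logDerivMatrix, ← Matrix.mul_assoc, Matrix.mul_nonsing_inv _ (hV.isUnit_det t),
    Matrix.one_mul]
  exact h1

/-- The derivative of the squared length of v_j is twice Re ∑ₗ v_j^* v_l P_lj, and the real-part
condition says exactly that this sum vanishes. -/
theorem colNormSq_eq (hk : 1 ≤ k) (hV : IsTransportedEigendecomposition k B V Lam)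
    (t : ℝ) (j : Fin n) : colNormSq (V t) j = colNormSq (V 0) j := by
  have hder : ∀ t, HasDerivAt (fun s => colNormSq (V s) j) 0 t := by
    intro t
    have h1 : HasDerivAt (fun s => colNormSq (V s) j)
        (∑ i, 2 * inner ℝ (V t i j) ((V t * logDerivMatrix V t) i j)) t :=
      HasDerivAt.fun_sum fun i _ => (hV.hasDerivAt_entry hk t i j).norm_sq
    convert h1 using 1
    rw [← Finset.mul_sum, eq_comm, mul_eq_zero]
    right
    have h2 := hV.real_part t j
    rw [eq_neg_iff_add_eq_zero, Finset.add_sum_erase Finset.univ (fun l =>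
      (dotProduct (star ((V t).col j)) ((V t).col l) * logDerivMatrix V t l j).re)
      (Finset.mem_univ j)] at h2
    rw [← h2]
    simp only [Complex.inner, Matrix.mul_apply, dotProduct, Finset.sum_mul,
      ← Complex.re_sum]
    rw [Finset.sum_comm]
    congr 1
    refine Finset.sum_congr rfl fun i _ => Finset.sum_congr rfl fun l _ => ?_
    simp only [Matrix.col_apply, Pi.star_apply, RCLike.star_def]
    ring
  exact is_const_of_deriv_eq_zero (fun t => (hder t).differentiableAt)
    (fun t => (hder t).deriv) t 0

theorem colNormSq_pos (hV : IsTransportedEigendecomposition k B V Lam)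
    (t : ℝ) (j : Fin n) : 0 < colNormSq (V t) j := by
  refine lt_of_le_of_ne (Finset.sum_nonneg fun i _ => sq_nonneg _) fun h => ?_
  have h0 : ∀ i, V t i j = 0 := fun i => by
    have := (Finset.sum_eq_zero_iff_of_nonneg (fun i _ => sq_nonneg ‖V t i j‖)).1 h.symm i
      (Finset.mem_univ i)
    simpa using this
  exact (hV.isUnit_det t).ne_zero (Matrix.det_eq_zero_of_column_eq_zero j h0)

/-- The determinant of the transported eigenvector matrix has constant argument. -/
theorem exists_det_eq (hk : 1 ≤ k) (hV : IsTransportedEigendecomposition k B V Lam) (t : ℝ) :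
    ∃ x : ℝ, 0 < x ∧ (V t).det = x * (V 0).det := by
  set ψ : ℝ → ℂ := fun s => (V s).det with hψ
  set P : ℝ → Matrix (Fin n) (Fin n) ℂ := logDerivMatrix V
  set τ : ℝ → ℝ := fun s => (∑ j, P s j j).re with hτ
  have hψ0 : ∀ s, ψ s ≠ 0 := fun s => (hV.isUnit_det s).ne_zero
  have hτP : ∀ s, ∑ j, P s j j = (τ s : ℂ) := by
    intro s
    refine Complex.ext (by simp [hτ]) ?_
    rw [Complex.im_sum, Complex.ofReal_im]
    exact Finset.sum_eq_zero fun j _ => hV.imag_part s j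
  have hder : ∀ s, HasDerivAt ψ (τ s * ψ s) s := by
    intro s
    convert Matrix.hasDerivAt_det (V := V) (t := s) (fun i j => hV.hasDerivAt_entry hk s i j)
      using 1
    simp only [Matrix.det_updateCol_mul]
    rw [← Finset.sum_mul, hτP]
  have hψC : ContDiff ℝ 1 ψ := by
    simp only [hψ, Matrix.det_apply']
    exact ContDiff.sum fun σ _ => contDiff_const.mul
      (contDiff_prod fun i _ => hV.contDiff_entry hk _ _)
  -- Continuity of the trace is read off from ψ'/ψ, so exp(-∫τ) is available as a real positive
  -- integrating factor.
  have hτc : Continuous τ := by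
    have : τ = fun s => (deriv ψ s / ψ s).re := by
      funext s
      rw [(hder s).deriv, mul_div_cancel_right₀ _ (hψ0 s), Complex.ofReal_re]
    rw [this]
    exact Complex.continuous_re.comp ((hψC.continuous_deriv le_rfl).div hψC.continuous hψ0)
  set J : ℝ → ℝ := fun s => ∫ x in (0 : ℝ)..s, τ x with hJ
  have hJd : ∀ s, HasDerivAt J (τ s) s := fun s => hτc.integral_hasStrictDerivAt 0 s |>.hasDerivAt
  have hconst : ∀ s, HasDerivAt (fun s => Complex.exp (-(J s : ℂ)) * ψ s) 0 s := by
    intro s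
    have h1 : HasDerivAt (fun s => Complex.exp (-(J s : ℂ)))
        (Complex.exp (-(J s : ℂ)) * -(τ s : ℂ)) s := ((hJd s).ofReal_comp.neg).cexp
    exact (h1.mul (hder s)).congr_deriv (by ring)
  have h2 := is_const_of_deriv_eq_zero (fun s => (hconst s).differentiableAt)
    (fun s => (hconst s).deriv) t 0
  have hJ0 : J 0 = 0 := by simp [hJ]
  refine ⟨Real.exp (J t), Real.exp_pos _, ?_⟩
  simp only [hJ0, Complex.ofReal_zero, neg_zero, Complex.exp_zero, one_mul] at h2
  change ψ t = _ * ψ 0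
  rw [← h2, Complex.ofReal_exp, ← mul_assoc, ← Complex.exp_add]
  simp

/-- Equal and constant column lengths give |c_j| = 1, so the logarithmic derivative of c_j is
imaginary; the condition on Im P_jj makes it real. Hence c_j is constant. Comparing determinants one
period apart then fixes the product of the phases. -/
theorem exists_phases (hk : 1 ≤ k) (hV : IsTransportedEigendecomposition k B V Lam)
    (π : Equiv.Perm (Fin n)) (c : Fin n → ℝ → ℂ)
    (hc : ∀ t j r, V (t + 1) r j = c j t * V t r (π j))
    (hnorm : ∀ j, colNormSq (V 0) j = colNormSq (V 0) (π j))
    (hsign : Equiv.Perm.sign π = 1) :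
    ∃ α : Fin n → ℝ, (∀ t j, c j t = Complex.exp (Complex.I * (α j : ℂ))) ∧
      ∃ m : ℤ, ∑ j, α j = 2 * Real.pi * m := by
  have hunit : ∀ j t, ‖c j t‖ = 1 := by
    intro j t
    have h1 : colNormSq (V (t + 1)) j = ‖c j t‖ ^ 2 * colNormSq (V t) (π j) := by
      simp only [colNormSq, Finset.mul_sum, hc, norm_mul, mul_pow]
    rw [hV.colNormSq_eq hk (t + 1), hV.colNormSq_eq hk t, hnorm] at h1
    have h2 : ‖c j t‖ ^ 2 = 1 :=
      mul_right_cancel₀ (hV.colNormSq_pos 0 (π j)).ne' (by rw [one_mul, ← h1])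
    exact (pow_eq_one_iff_of_nonneg (norm_nonneg _) two_ne_zero).1 h2
  have hc0 : ∀ j t, c j t ≠ 0 := fun j t h => by
    have := hunit j t
    rw [h, norm_zero] at this
    exact zero_ne_one this
  -- Locally c_j is a quotient of entries of V, since column π j has a nonzero entry.
  have hcd : ∀ j, Differentiable ℝ (c j) := by
    intro j t
    obtain ⟨r, hr⟩ : ∃ r, V t r (π j) ≠ 0 := by
      by_contra! h0
      exact (hV.isUnit_det t).ne_zero (Matrix.det_eq_zero_of_column_eq_zero (π j) h0)
    have hd1 := (hV.contDiff_entry hk r (π j)).differentiable one_ne_zero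
    have hd2 := (hV.contDiff_entry hk r j).differentiable one_ne_zero
    have hd3 : DifferentiableAt ℝ (fun s => V (s + 1) r j / V s r (π j)) t :=
      (hd2.comp (differentiable_id.add_const 1) t).div (hd1 t) hr
    refine hd3.congr_of_eventuallyEq ?_
    filter_upwards [(hd1 t).continuousAt.eventually_ne hr] with s hs
    rw [hc, mul_div_cancel_right₀ _ hs]
  have hder0 : ∀ j t, deriv (c j) t = 0 := by
    intro j t
    set W := V (t + 1) with hW
    have hWu := hV.isUnit_det (t + 1)
    have e1 : ∀ r, (W * logDerivMatrix V (t + 1)) r j =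
        deriv (c j) t * V t r (π j) + c j t * (V t * logDerivMatrix V t) r (π j) := by
      intro r
      have h1 := (hV.hasDerivAt_entry hk (t + 1) r j).comp_add_const t 1
      have h2 := (hcd j t).hasDerivAt.mul (hV.hasDerivAt_entry hk t r (π j))
      refine h1.unique (h2.congr_of_eventuallyEq (Filter.Eventually.of_forall fun s => ?_))
      exact hc s j r
    have e2 : ∀ l l', (W⁻¹ * V t) l (π l') = if l = l' then (c l' t)⁻¹ else 0 := by
      intro l l'
      have h1 : ∀ r, V t r (π l') = (c l' t)⁻¹ * W r l' := fun r => by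
        rw [hW, hc, inv_mul_cancel_left₀ (hc0 l' t)]
      have h2 := congrFun (congrFun (Matrix.nonsing_inv_mul W hWu) l) l'
      rw [Matrix.mul_apply, Matrix.one_apply] at h2
      rw [Matrix.mul_apply]
      simp only [h1, mul_left_comm _ (c l' t)⁻¹, ← Finset.mul_sum, h2]
      split_ifs <;> simp
    -- Diagonal entry of the differentiated relation V(t+1) = V(t) · (monomial matrix): P(t+1)_jj is
    -- the logarithmic derivative of c_j plus P(t) at π j.
    have e3 : logDerivMatrix V (t + 1) j j =
        deriv (c j) t * (c j t)⁻¹ + logDerivMatrix V t (π j) (π j) := by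
      have h1 : logDerivMatrix V (t + 1) j j =
          ∑ r, W⁻¹ j r * (W * logDerivMatrix V (t + 1)) r j := by
        rw [← Matrix.mul_apply, ← Matrix.mul_assoc, Matrix.nonsing_inv_mul W hWu, Matrix.one_mul]
      rw [h1]
      simp only [e1, mul_add, Finset.sum_add_distrib, mul_left_comm _ (deriv (c j) t),
        mul_left_comm _ (c j t), ← Finset.mul_sum, ← Matrix.mul_apply]
      rw [e2, if_pos rfl, ← Matrix.mul_assoc, Matrix.mul_apply, ← Equiv.sum_comp π]
      simp only [e2, ite_mul, zero_mul, Finset.sum_ite_eq, Finset.mem_univ, if_true]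
      rw [mul_inv_cancel_left₀ (hc0 j t)]
    have him : (deriv (c j) t * (c j t)⁻¹).im = 0 := by
      have h1 := congrArg Complex.im e3
      rw [Complex.add_im, hV.imag_part, hV.imag_part, add_zero] at h1
      exact h1.symm
    have hinv : (c j t)⁻¹ = (starRingEnd ℂ) (c j t) := by
      rw [Complex.inv_def, Complex.normSq_eq_norm_sq, hunit]
      simp
    have hre : (deriv (c j) t * (c j t)⁻¹).re = 0 := by
      have h1 := (hcd j t).hasDerivAt.norm_sq
      have h2 : HasDerivAt (fun s => ‖c j s‖ ^ 2) 0 t := by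
        simp only [hunit, one_pow]
        exact hasDerivAt_const t 1
      have h3 := h1.unique h2
      rw [Complex.inner, mul_eq_zero] at h3
      rw [hinv]
      simpa using h3
    have h4 : deriv (c j) t * (c j t)⁻¹ = 0 := Complex.ext hre him
    exact (mul_eq_zero.1 h4).resolve_right (inv_ne_zero (hc0 j t))
  have hconst : ∀ j t, c j t = c j 0 := fun j t =>
    is_const_of_deriv_eq_zero (hcd j) (hder0 j) t 0
  have hexp : ∀ t j, c j t = Complex.exp (Complex.I * (Complex.arg (c j 0) : ℂ)) := by
    intro t j
    have := Complex.norm_mul_exp_arg_mul_I (c j 0)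
    rw [hunit, Complex.ofReal_one, one_mul] at this
    rw [hconst, mul_comm, this]
  refine ⟨fun j => Complex.arg (c j 0), hexp, ?_⟩
  have hV1 : V (0 + 1) = (V 0).submatrix id π * Matrix.diagonal fun j => c j 0 := by
    ext r j
    rw [hc, Matrix.mul_diagonal, Matrix.submatrix_apply, id, mul_comm]
  obtain ⟨x, hx, hdet⟩ := hV.exists_det_eq hk (0 + 1)
  have hprod : ∏ j, c j 0 = x := by
    rw [hV1, Matrix.det_mul, Matrix.det_permute', hsign, Matrix.det_diagonal] at hdet
    have h0 := (hV.isUnit_det 0).ne_zero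
    refine mul_left_cancel₀ h0 ?_
    rw [mul_comm _ (x : ℂ), ← hdet]
    simp
  have hx1 : x = 1 := by
    have := congrArg norm hprod
    rw [norm_prod] at this
    simp only [hunit, Finset.prod_const_one, Complex.norm_real, Real.norm_eq_abs,
      abs_of_pos hx] at this
    exact this.symm
  rw [hx1, Finset.prod_congr rfl fun j _ => hexp 0 j, ← Complex.exp_sum, Complex.ofReal_one,
    Complex.exp_eq_one_iff] at hprod
  obtain ⟨m, hm⟩ := hprod
  refine ⟨m, ?_⟩
  rw [← Finset.mul_sum] at hm
  have h5 : ((∑ j, Complex.arg (c j 0) : ℝ) : ℂ) = ((2 * Real.pi * m : ℝ) : ℂ) := by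
    refine mul_left_cancel₀ Complex.I_ne_zero ?_
    push_cast
    rw [hm]
    ring
  exact_mod_cast h5

/-- If the eigenvalues at each parameter are distinct, the eigenvectors after one period are
multiples of the permuted eigenvectors. -/
theorem exists_coeff (hV : IsTransportedEigendecomposition k B V Lam)
    (hB : ∀ t, B (t + 1) = B t) (hinj : ∀ t, Function.Injective fun j => Lam j t)
    (π : Equiv.Perm (Fin n)) (hπ : ∀ t j, Lam j (t + 1) = Lam (π j) t) :
    ∃ c : Fin n → ℝ → ℂ, ∀ t j r, V (t + 1) r j = c j t * V t r (π j) := by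
  refine ⟨fun j t => ((V t)⁻¹ * V (t + 1)) (π j) j, fun t j r => ?_⟩
  set M := (V t)⁻¹ * V (t + 1) with hM
  have hVM : V (t + 1) = V t * M := by
    rw [hM, ← Matrix.mul_assoc, Matrix.mul_nonsing_inv _ (hV.isUnit_det t), Matrix.one_mul]
  -- Both ends of the period decompose the same matrix, so M intertwines the two diagonals. Distinct
  -- eigenvalues then kill every entry outside the permutation pattern.
  have hcomm : Matrix.diagonal (fun j => Lam j t) * M =
      M * Matrix.diagonal (fun j => Lam j (t + 1)) := by
    have h1 := hV.decomposition (t + 1)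
    rw [hB, hV.decomposition t] at h1
    have h2 := congrArg (fun X => (V t)⁻¹ * (X * V (t + 1))) h1
    simp only [Matrix.mul_assoc] at h2
    rw [Matrix.nonsing_inv_mul _ (hV.isUnit_det (t + 1)), Matrix.mul_one, ← Matrix.mul_assoc,
      Matrix.nonsing_inv_mul _ (hV.isUnit_det t), Matrix.one_mul] at h2
    rw [hM, h2, Matrix.mul_assoc]
  have hzero : ∀ i, i ≠ π j → M i j = 0 := by
    intro i hi
    have h1 := congrFun (congrFun hcomm i) j
    rw [Matrix.diagonal_mul, Matrix.mul_diagonal, hπ, mul_comm, ← sub_eq_zero, ← mul_sub,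
      mul_eq_zero, sub_eq_zero] at h1
    exact h1.resolve_right fun h => hi (hinj t h)
  rw [hVM, Matrix.mul_apply, Finset.sum_eq_single (π j) (fun i _ hi => by rw [hzero i hi, mul_zero])
    (by simp), mul_comm]

end IsTransportedEigendecomposition

/-! ### Eigenvalues near a generic cuspidal point. -/

theorem Matrix.charpoly_eq_of_eq_conj {n : ℕ} {B T D : Matrix (Fin n) (Fin n) ℂ}
    (hT : IsUnit T.det) (h : B = T * D * T⁻¹) : B.charpoly = D.charpoly := by
  rw [h, Matrix.charpoly_mul_comm, ← Matrix.mul_assoc, Matrix.nonsing_inv_mul T hT, Matrix.one_mul]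

/-- The eigenvalues of a `2 × 2` matrix in terms of a square root of the discriminant. -/
theorem charpoly_roots_fin_two (E : Matrix (Fin 2) (Fin 2) ℂ) {s : ℂ} (hs : s ^ 2 = discr2 E) :
    E.charpoly.roots = {(E.trace + s) / 2, (E.trace - s) / 2} := by
  have h : E.charpoly = (({(E.trace + s) / 2, (E.trace - s) / 2} : Multiset ℂ).map
      fun a => Polynomial.X - Polynomial.C a).prod := by
    have hdet : E.det = (E.trace + s) / 2 * ((E.trace - s) / 2) := by
      rw [show (E.trace + s) / 2 * ((E.trace - s) / 2) = (E.trace ^ 2 - s ^ 2) / 4 by ring, hs,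
        Matrix.det_fin_two, Matrix.trace_fin_two, discr2]
      ring
    have htr : E.trace = (E.trace + s) / 2 + (E.trace - s) / 2 := by ring
    rw [Matrix.charpoly_fin_two, hdet]
    nth_rewrite 1 [htr]
    simp only [Multiset.insert_eq_cons, Multiset.map_cons, Multiset.map_singleton,
      Multiset.prod_cons, Multiset.prod_singleton, Polynomial.C_add, Polynomial.C_mul]
    ring
  rw [h, Polynomial.roots_multiset_prod_X_sub_C]

theorem roots_prod_X_sub_C_univ {n : ℕ} (f : Fin n → ℂ) :
    (∏ j, (Polynomial.X - Polynomial.C (f j))).roots = Finset.univ.val.map f := by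
  have h1 : ∏ j, (Polynomial.X - Polynomial.C (f j)) =
      ((Finset.univ.val.map f).map fun a => Polynomial.X - Polynomial.C a).prod := by
    rw [Multiset.map_map]
    rfl
  rw [h1, Polynomial.roots_multiset_prod_X_sub_C]

theorem IsEigenvalueLabeling.roots_eq {n : ℕ} {Ω : Set (ℝ × ℝ)}
    {A : ℝ × ℝ → Matrix (Fin n) (Fin n) ℂ} {lam : Fin n → ℝ × ℝ → ℂ}
    (h : IsEigenvalueLabeling Ω A lam) {ξ : ℝ × ℝ} (hξ : ξ ∈ Ω) :
    (A ξ).charpoly.roots = Finset.univ.val.map fun j => lam j ξ := by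
  rw [h ξ hξ, roots_prod_X_sub_C_univ]

theorem IsEigenvalueLabeling.injective {n : ℕ} {Ω : Set (ℝ × ℝ)}
    {A : ℝ × ℝ → Matrix (Fin n) (Fin n) ℂ} {lam : Fin n → ℝ × ℝ → ℂ}
    (h : IsEigenvalueLabeling Ω A lam) {ξ : ℝ × ℝ} (hξ : ξ ∈ Ω) (hs : SimpleSpectrum (A ξ)) :
    Function.Injective fun j => lam j ξ := by
  rw [SimpleSpectrum, h.roots_eq hξ] at hs
  exact fun i j e => Multiset.inj_on_of_nodup_map hs i (Finset.mem_univ i) j (Finset.mem_univ j) e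

/-- (a - b)² = (a + b)² - 4ab is symmetric in the pair. -/
theorem Multiset.sq_sub_eq_of_pair_eq {a b c d : ℂ} (h : ({a, b} : Multiset ℂ) = {c, d}) :
    (a - b) ^ 2 = (c - d) ^ 2 := by
  have h1 := congrArg Multiset.sum h
  have h2 := congrArg Multiset.prod h
  simp only [Multiset.insert_eq_cons, Multiset.sum_cons, Multiset.sum_singleton,
    Multiset.prod_cons, Multiset.prod_singleton] at h1 h2
  linear_combination (a + b + c + d) * h1 - 4 * h2

/-- Near a generic cuspidal point two eigenvalues are `(τ ± √D) / 2`, where `D` vanishes to first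
order at the point, and at the point itself the other eigenvalues are simple. -/
theorem IsGCP.exists_local {n : ℕ} {k : ℕ∞} {Ω : Set (ℝ × ℝ)}
    {A : ℝ × ℝ → Matrix (Fin n) (Fin n) ℂ} (hA : MatContDiffOn k A Ω) (hΩ : IsOpen Ω)
    {ξ₀ : ℝ × ℝ} (h : IsGCP k Ω A ξ₀) :
    ∃ (D τ s : ℝ × ℝ → ℂ) (S : ℝ × ℝ → Multiset ℂ) (L : (ℝ × ℝ) ≃L[ℝ] ℂ),
      D ξ₀ = 0 ∧ HasFDerivAt D (L : (ℝ × ℝ) →L[ℝ] ℂ) ξ₀ ∧ ContinuousAt τ ξ₀ ∧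
      (∀ ξ, s ξ ^ 2 = D ξ) ∧
      (∀ᶠ ξ in nhds ξ₀, (A ξ).charpoly.roots = {(τ ξ + s ξ) / 2, (τ ξ - s ξ) / 2} + S ξ) ∧
      (S ξ₀).Nodup ∧ τ ξ₀ / 2 ∉ S ξ₀ := by
  obtain ⟨a₁, b₁, a₂, b₂, hR, hξR, e, T, E₁, E₂, hT, hdec, hzero, M, hM⟩ := h
  set R := Set.Icc a₁ b₁ ×ˢ Set.Icc a₂ b₂
  have hRn : R ∈ nhds ξ₀ := by
    refine Filter.mem_of_superset ((isOpen_Ioo.prod isOpen_Ioo).mem_nhds hξR) ?_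
    exact Set.prod_mono Set.Ioo_subset_Icc_self Set.Ioo_subset_Icc_self
  have hξR' : ξ₀ ∈ R := mem_of_mem_nhds hRn
  have hD : ∀ ξ, discr2 (E₁ ξ) = Complex.equivRealProdCLM.symm (discrMap E₁ ξ) := fun ξ => by
    rw [Complex.equivRealProdCLM_symm_apply, discrMap, Complex.re_add_im]
  -- `fderiv` takes the value 0 where the function is not differentiable, and 0 is not invertible on
  -- ℝ², so differentiability comes with the regularity condition.
  have hdiff : DifferentiableAt ℝ (discrMap E₁) ξ₀ := by
    by_contra hnd
    rw [fderiv_zero_of_not_differentiableAt hnd] at hM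
    have h1 : M ((1, 0) : ℝ × ℝ) = 0 := DFunLike.congr_fun hM (1, 0)
    have h2 := (map_eq_zero_iff M M.injective).1 h1
    simp at h2
  have hTc : ContinuousAt T ξ₀ := by
    refine continuousAt_pi.2 fun i => continuousAt_pi.2 fun j => ?_
    exact (hT i j).continuousOn.continuousAt hRn
  have hAc : ContinuousAt A ξ₀ := by
    refine continuousAt_pi.2 fun i => continuousAt_pi.2 fun j => ?_
    exact (hA i j).continuousOn.continuousAt (hΩ.mem_nhds (hR hξR'))
  have hTinv : ContinuousAt (fun ξ => (T ξ)⁻¹) ξ₀ := by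
    have h1 : ContinuousAt (fun ξ => (T ξ).det) ξ₀ :=
      (Continuous.matrix_det continuous_id).continuousAt.comp hTc
    have h2 : ContinuousAt (fun ξ => (T ξ).adjugate) ξ₀ :=
      (Continuous.matrix_adjugate continuous_id).continuousAt.comp hTc
    simp only [Matrix.inv_def, Ring.inverse_eq_inv']
    exact (h1.inv₀ (hdec ξ₀ hξR').1.ne_zero).smul h2
  have hconj : ContinuousAt (fun ξ => (T ξ)⁻¹ * A ξ * T ξ) ξ₀ := (hTinv.mul hAc).mul hTc
  have hentry : ∀ i, ContinuousAt (fun ξ => E₁ ξ i i) ξ₀ := by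
    intro i
    have h1 : ContinuousAt (fun ξ => ((T ξ)⁻¹ * A ξ * T ξ) (e (Sum.inl i)) (e (Sum.inl i))) ξ₀ :=
      continuousAt_pi.1 (continuousAt_pi.1 hconj _) _
    refine h1.congr ?_
    filter_upwards [hRn] with ξ hξ
    rw [(hdec ξ hξ).2.1]
    simp
  choose s hs using fun ξ => IsSquare.exists_sq (discr2 (E₁ ξ)) (Complex.isSquare _)
  have hD0 : discr2 (E₁ ξ₀) = 0 := by rw [hD, hzero, map_zero]
  refine ⟨fun ξ => discr2 (E₁ ξ), fun ξ => (E₁ ξ).trace, s, fun ξ => (E₂ ξ).charpoly.roots,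
    M.trans Complex.equivRealProdCLM.symm, hD0, ?_, ?_, fun ξ => (hs ξ).symm, ?_,
    (hdec ξ₀ hξR').2.2.2, fun hmem => ?_⟩
  · simp only [hD]
    have h1 := hdiff.hasFDerivAt
    rw [← hM] at h1
    exact Complex.equivRealProdCLM.symm.hasFDerivAt.comp ξ₀ h1
  · simp only [Matrix.trace_fin_two]
    exact (hentry 0).add (hentry 1)
  · filter_upwards [hRn] with ξ hξ
    obtain ⟨hu, hc, -, -⟩ := hdec ξ hξ
    have h1 : A ξ = T ξ * Matrix.reindex e e (Matrix.fromBlocks (E₁ ξ) 0 0 (E₂ ξ)) * (T ξ)⁻¹ := by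
      rw [← hc, Matrix.mul_assoc, Matrix.mul_assoc, Matrix.mul_nonsing_inv _ hu, Matrix.mul_one,
        ← Matrix.mul_assoc, Matrix.mul_nonsing_inv _ hu, Matrix.one_mul]
    rw [Matrix.charpoly_eq_of_eq_conj hu h1, Matrix.charpoly_reindex,
      Matrix.charpoly_fromBlocks_zero₁₂, Polynomial.roots_mul
        (mul_ne_zero (Matrix.charpoly_monic _).ne_zero (Matrix.charpoly_monic _).ne_zero),
      charpoly_roots_fin_two _ (hs ξ).symm]
  · have h1 : s ξ₀ = 0 := by
      have := hs ξ₀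
      rw [hD0] at this
      exact pow_eq_zero_iff two_ne_zero |>.1 this.symm
    refine Set.disjoint_left.1 (hdec ξ₀ hξR').2.2.1 (?_ : (E₁ ξ₀).trace / 2 ∈ _) ?_
    · rw [Matrix.mem_spectrum_iff_isRoot_charpoly, ← Polynomial.mem_roots
        (Matrix.charpoly_monic _).ne_zero, charpoly_roots_fin_two _ (hs ξ₀).symm, h1]
      simp
    · rw [Matrix.mem_spectrum_iff_isRoot_charpoly]
      exact Polynomial.isRoot_of_mem_roots hmem

/-- At a generic cuspidal point exactly two labels coincide, and their squared difference vanishes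
there to first order. -/
theorem IsGCP.sq_sub_eq {n : ℕ} {k : ℕ∞} {Ω : Set (ℝ × ℝ)}
    {A : ℝ × ℝ → Matrix (Fin n) (Fin n) ℂ} (hA : MatContDiffOn k A Ω) (hΩ : IsOpen Ω)
    {ξ₀ : ℝ × ℝ} (hξ₀ : ξ₀ ∈ Ω) (h : IsGCP k Ω A ξ₀) {lam : Fin n → ℝ × ℝ → ℂ}
    (hlam : IsEigenvalueLabeling Ω A lam) {i₀ i₁ : Fin n} (hi : i₀ ≠ i₁)
    (hcoal : lam i₀ ξ₀ = lam i₁ ξ₀) :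
    (∀ i j, lam i ξ₀ = lam j ξ₀ → i ≠ j → i = i₀ ∨ i = i₁) ∧
    ((∀ ε > 0, ∀ᶠ ξ in nhds ξ₀, ∀ j, j ≠ i₀ → j ≠ i₁ →
        ∃ l, l ≠ i₀ ∧ l ≠ i₁ ∧ dist (lam j ξ) (lam l ξ₀) < ε) →
      ∃ (D : ℝ × ℝ → ℂ) (L : (ℝ × ℝ) ≃L[ℝ] ℂ), D ξ₀ = 0 ∧
        HasFDerivAt D (L : (ℝ × ℝ) →L[ℝ] ℂ) ξ₀ ∧
        ∀ᶠ ξ in nhds ξ₀, (lam i₀ ξ - lam i₁ ξ) ^ 2 = D ξ) := by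
  classical
  obtain ⟨D, τ, s, S, L, hD0, hDL, hτ, hs, hroots, hS, hτS⟩ := h.exists_local hA hΩ
  have hs0 : s ξ₀ = 0 := by
    have := hs ξ₀
    rw [hD0] at this
    exact pow_eq_zero_iff two_ne_zero |>.1 this
  have hr0 : (Finset.univ.val.map fun j => lam j ξ₀) = {τ ξ₀ / 2, τ ξ₀ / 2} + S ξ₀ := by
    rw [← hlam.roots_eq hξ₀, hroots.self_of_nhds, hs0, add_zero, sub_zero]
  have hcount : ∀ z, (Finset.univ.filter fun j => z = lam j ξ₀).card =
      Multiset.count z ({τ ξ₀ / 2, τ ξ₀ / 2} + S ξ₀) := by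
    intro z
    rw [← hr0, Multiset.count_map]
    rfl
  have hmu : ∀ i j, lam i ξ₀ = lam j ξ₀ → i ≠ j → lam i ξ₀ = τ ξ₀ / 2 := by
    intro i j hij hne
    by_contra hz
    have h1 : ({i, j} : Finset (Fin n)) ⊆ Finset.univ.filter fun l => lam i ξ₀ = lam l ξ₀ := by
      intro l hl
      rcases Finset.mem_insert.1 hl with rfl | hl
      · simp
      · rw [Finset.mem_singleton.1 hl]; simpa using hij
    have h2 := Finset.card_le_card h1
    rw [Finset.card_pair hne, hcount, Multiset.count_add] at h2
    have h3 := Multiset.nodup_iff_count_le_one.1 hS (lam i ξ₀)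
    have h4 : Multiset.count (lam i ξ₀) {τ ξ₀ / 2, τ ξ₀ / 2} = 0 := by
      rw [Multiset.count_eq_zero]; simpa using hz
    omega
  -- By `hmu` every coincidence occurs at the value τ/2, whose multiplicity is exactly two because
  -- it is not in `S ξ₀`.
  have hfilter : (Finset.univ.filter fun j => τ ξ₀ / 2 = lam j ξ₀) = {i₀, i₁} := by
    refine (Finset.eq_of_subset_of_card_le (fun l hl => ?_) ?_).symm
    · rcases Finset.mem_insert.1 hl with rfl | hl
      · simpa using (hmu _ _ hcoal hi).symm
      · rw [Finset.mem_singleton.1 hl]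
        simpa using (hmu _ _ hcoal.symm hi.symm).symm
    · rw [hcount, Finset.card_pair hi, Multiset.count_add, Multiset.count_eq_zero.2 hτS]
      simp
  refine ⟨fun i j hij hne => ?_, fun hother => ⟨D, L, hD0, hDL, ?_⟩⟩
  · have : i ∈ Finset.univ.filter fun j => τ ξ₀ / 2 = lam j ξ₀ := by
      simpa using (hmu i j hij hne).symm
    rw [hfilter] at this
    simpa using this
  · obtain ⟨r, hr, hsep⟩ :=
      (Set.finite_range fun j => lam j ξ₀).exists_separation
    have hfar : ∀ l, l ≠ i₀ → l ≠ i₁ → 2 * r ≤ dist (lam l ξ₀) (τ ξ₀ / 2) := by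
      intro l hl0 hl1
      by_contra hlt
      have h1 : lam l ξ₀ = τ ξ₀ / 2 := by
        rw [← hmu _ _ hcoal hi] at hlt ⊢
        exact hsep _ ⟨l, rfl⟩ _ ⟨i₀, rfl⟩ (not_le.1 hlt)
      have : l ∈ Finset.univ.filter fun j => τ ξ₀ / 2 = lam j ξ₀ := by simpa using h1.symm
      rw [hfilter] at this
      simp [hl0, hl1] at this
    -- The root s is chosen pointwise, but its norm is √‖D‖, so it still tends to zero at ξ₀.
    have hsc : Filter.Tendsto s (nhds ξ₀) (nhds 0) := by
      rw [tendsto_zero_iff_norm_tendsto_zero]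
      have h1 : Filter.Tendsto (fun ξ => Real.sqrt ‖D ξ‖) (nhds ξ₀) (nhds 0) := by
        have := (hDL.continuousAt.norm).sqrt
        rwa [ContinuousAt, hD0, norm_zero, Real.sqrt_zero] at this
      refine h1.congr fun ξ => ?_
      rw [← hs, norm_pow, Real.sqrt_sq (norm_nonneg _)]
    have hp : Filter.Tendsto (fun ξ => (τ ξ + s ξ) / 2) (nhds ξ₀) (nhds (τ ξ₀ / 2)) := by
      have := (Filter.Tendsto.add hτ hsc).div_const 2
      rwa [add_zero] at this
    have hm : Filter.Tendsto (fun ξ => (τ ξ - s ξ) / 2) (nhds ξ₀) (nhds (τ ξ₀ / 2)) := by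
      have := (Filter.Tendsto.sub hτ hsc).div_const 2
      rwa [sub_zero] at this
    filter_upwards [hother r hr, hroots, hΩ.mem_nhds hξ₀, hp (Metric.ball_mem_nhds _ hr),
      hm (Metric.ball_mem_nhds _ hr)] with ξ h1 h2 h3 h4 h5
    rw [hlam.roots_eq h3] at h2
    -- Squeeze by counting: both perturbed values lie in the r-ball about τ/2, while `h1` keeps
    -- every label other than i₀, i₁ out of it. Two multisets of size two, one below the other, are
    -- equal.
    have h6 : ({(τ ξ + s ξ) / 2, (τ ξ - s ξ) / 2} : Multiset ℂ) ≤
        (Finset.univ.val.map fun j => lam j ξ).filter (fun z => dist z (τ ξ₀ / 2) < r) := by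
      rw [Multiset.le_filter]
      refine ⟨by rw [h2]; exact Multiset.le_add_right _ _, fun z hz => ?_⟩
      rcases Multiset.mem_cons.1 hz with rfl | hz
      · exact h4
      · rw [Multiset.mem_singleton.1 hz]; exact h5
    have h7 : (Finset.univ.val.map fun j => lam j ξ).filter (fun z => dist z (τ ξ₀ / 2) < r) ≤
        ({lam i₀ ξ, lam i₁ ξ} : Multiset ℂ) := by
      have hpair : ({lam i₀ ξ, lam i₁ ξ} : Multiset ℂ) =
          ({i₀, i₁} : Finset (Fin n)).val.map fun j => lam j ξ := by
        rw [Finset.insert_val_of_notMem (by simpa using hi)]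
        rfl
      rw [Multiset.filter_map, hpair]
      refine Multiset.map_le_map ?_
      change (Finset.univ.filter fun j => dist (lam j ξ) (τ ξ₀ / 2) < r).val ≤ _
      rw [Finset.val_le_iff]
      intro j hj
      have hj' : dist (lam j ξ) (τ ξ₀ / 2) < r := by simpa using hj
      by_contra hcon
      simp only [Finset.mem_insert, Finset.mem_singleton, not_or] at hcon
      obtain ⟨l, hl0, hl1, hl⟩ := h1 j hcon.1 hcon.2
      have := hfar l hl0 hl1
      rw [dist_comm] at hl
      linarith [dist_triangle (lam l ξ₀) (lam j ξ) (τ ξ₀ / 2)]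
    have h8 := Multiset.eq_of_le_of_card_le (h6.trans h7) (by simp)
    rw [← Multiset.sq_sub_eq_of_pair_eq h8, ← hs]
    ring

/-! ### Squared differences of pairs along the curve. -/

/-- Two sets of complex numbers are within distance `ε` of each other, each point of either set
having a point of the other one nearby. -/
def MutuallyNear (ε : ℝ) (S T : Set ℂ) : Prop :=
  (∀ z ∈ S, ∃ w ∈ T, dist z w < ε) ∧ ∀ w ∈ T, ∃ z ∈ S, dist z w < ε

theorem SetContinuousOn.eventually_mutuallyNear {G : ℝ × ℝ → Set ℂ} {Ω : Set (ℝ × ℝ)}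
    (h : SetContinuousOn G Ω) (hfin : ∀ ξ, (G ξ).Finite) (hne : ∀ ξ, (G ξ).Nonempty)
    {ξ : ℝ × ℝ} (hξ : ξ ∈ Ω) {ε : ℝ} (hε : 0 < ε) :
    ∀ᶠ η in nhdsWithin ξ Ω, MutuallyNear ε (G η) (G ξ) := by
  filter_upwards [(h ξ hξ).eventually_lt_const hε] with η hη
  have hfinite := Metric.hausdorffEDist_ne_top_of_nonempty_of_bounded (hne η) (hne ξ)
    (hfin η).isBounded (hfin ξ).isBounded
  exact ⟨fun z hz => Metric.exists_dist_lt_of_hausdorffDist_lt hz hη hfinite,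
    fun w hw => Metric.exists_dist_lt_of_hausdorffDist_lt' hw hη hfinite⟩

theorem labelGroup_finite {n : ℕ} (lam : Fin n → ℝ × ℝ → ℂ) (J : Set (Fin n)) (ξ : ℝ × ℝ) :
    (labelGroup lam J ξ).Finite := (Set.toFinite J).image _

theorem norm_sq_sub_sq_le_of_mutuallyNear {a b a' b' : ℂ} {ε : ℝ}
    (h : MutuallyNear ε {a, b} {a', b'}) :
    ‖(a - b) ^ 2 - (a' - b') ^ 2‖ ≤ 4 * ε * (4 * ε + 2 * ‖a' - b'‖) := by
  obtain ⟨h1, h2⟩ := h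
  -- Nearness of unordered pairs matches the points either directly or crosswise, which determines a
  -- - b only up to sign. Either factor of the difference of squares may be the small one.
  have key : ‖(a - b) - (a' - b')‖ ≤ 4 * ε ∨ ‖(a - b) + (a' - b')‖ ≤ 4 * ε := by
    have ha : dist a a' < ε ∨ dist a b' < ε := by simpa using h1 a (by simp)
    have hb : dist b a' < ε ∨ dist b b' < ε := by simpa using h1 b (by simp)
    have ha' : dist a a' < ε ∨ dist b a' < ε := by simpa using h2 a' (by simp)
    have hb' : dist a b' < ε ∨ dist b b' < ε := by simpa using h2 b' (by simp)
    have d1 : ‖(a - b) - (a' - b')‖ ≤ dist a a' + dist b b' := by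
      rw [dist_eq_norm, dist_eq_norm, show (a - b) - (a' - b') = (a - a') - (b - b') by ring]
      exact norm_sub_le _ _
    have d2 : ‖(a - b) + (a' - b')‖ ≤ dist a b' + dist b a' := by
      rw [dist_eq_norm, dist_eq_norm, show (a - b) + (a' - b') = (a - b') - (b - a') by ring]
      exact norm_sub_le _ _
    have t1 : dist b b' ≤ dist a b' + dist a a' + dist b a' := by
      have := dist_triangle4 b a' a b'
      rw [dist_comm a' a] at this
      linarith
    have t2 : dist a a' ≤ dist a b' + dist b b' + dist b a' := by
      have := dist_triangle4 a b' b a'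
      rw [dist_comm b' b] at this
      linarith
    have p1 := dist_nonneg (x := a) (y := a')
    have p2 := dist_nonneg (x := a) (y := b')
    have p3 := dist_nonneg (x := b) (y := a')
    have p4 := dist_nonneg (x := b) (y := b')
    rcases ha with ha | ha <;> rcases hb with hb | hb <;> rcases ha' with ha' | ha' <;>
      rcases hb' with hb' | hb' <;>
      first
        | exact Or.inl (by linarith)
        | exact Or.inr (by linarith)
  have hfac : (a - b) ^ 2 - (a' - b') ^ 2 =
      ((a - b) - (a' - b')) * ((a - b) + (a' - b')) := by ring
  have hd2 : ‖2 * (a' - b')‖ = 2 * ‖a' - b'‖ := by rw [norm_mul]; simp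
  rw [hfac, norm_mul]
  rcases key with hk | hk
  · have h3 : ‖(a - b) + (a' - b')‖ ≤ 4 * ε + 2 * ‖a' - b'‖ := by
      have := norm_add_le ((a - b) - (a' - b')) (2 * (a' - b'))
      rw [show (a - b) - (a' - b') + 2 * (a' - b') = (a - b) + (a' - b') by ring] at this
      linarith
    exact mul_le_mul hk h3 (norm_nonneg _) ((norm_nonneg _).trans hk)
  · have h3 : ‖(a - b) - (a' - b')‖ ≤ 4 * ε + 2 * ‖a' - b'‖ := by
      have := norm_sub_le ((a - b) + (a' - b')) (2 * (a' - b'))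
      rw [show (a - b) + (a' - b') - 2 * (a' - b') = (a - b) - (a' - b') by ring] at this
      linarith
    rw [mul_comm]
    exact mul_le_mul hk h3 (norm_nonneg _) ((norm_nonneg _).trans hk)

/-- The squared difference depends only on the unordered pair, so continuity of the set suffices
although the labels may jump. -/
theorem continuousOn_sq_sub {a b : ℝ × ℝ → ℂ} {Ω : Set (ℝ × ℝ)}
    (h : ∀ ξ ∈ Ω, ∀ ε > 0, ∀ᶠ η in nhdsWithin ξ Ω, MutuallyNear ε {a η, b η} {a ξ, b ξ}) :
    ContinuousOn (fun ξ => (a ξ - b ξ) ^ 2) Ω := by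
  intro ξ hξ
  rw [ContinuousWithinAt, Metric.tendsto_nhds]
  intro e he
  have hc : Filter.Tendsto (fun ε : ℝ => 4 * ε * (4 * ε + 2 * ‖a ξ - b ξ‖))
      (nhdsWithin 0 (Set.Ioi 0)) (nhds 0) := by
    have : Continuous fun ε : ℝ => 4 * ε * (4 * ε + 2 * ‖a ξ - b ξ‖) := by fun_prop
    have h0 := (this.tendsto 0).mono_left (nhdsWithin_le_nhds (s := Set.Ioi 0))
    simpa using h0
  obtain ⟨ε, hε, hε0⟩ := ((hc.eventually_lt_const he).and self_mem_nhdsWithin).exists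
  filter_upwards [h ξ hξ ε hε0] with η hη
  rw [dist_eq_norm]
  exact (norm_sq_sub_sq_le_of_mutuallyNear hη).trans_lt hε

/-- If `f` vanishes only at `ξ₀`, and there to first order, then along a Jordan curve encircling
`ξ₀` the square roots of `f` change sign. -/
theorem hasAntiperiodicSqrt_comp {Ω : Set (ℝ × ℝ)} (hΩ : IsOpen Ω) (hconv : Convex ℝ Ω)
    {ξ₀ : ℝ × ℝ} (hξ₀ : ξ₀ ∈ Ω) {f D : ℝ × ℝ → ℂ} (hf : ContinuousOn f Ω)
    (hf0 : ∀ ξ ∈ Ω, ξ ≠ ξ₀ → f ξ ≠ 0) {L : (ℝ × ℝ) ≃L[ℝ] ℂ} (hD0 : D ξ₀ = 0)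
    (hD : HasFDerivAt D (L : (ℝ × ℝ) →L[ℝ] ℂ) ξ₀) (hfD : ∀ᶠ ξ in nhds ξ₀, f ξ = D ξ)
    {γ : ℝ → ℝ × ℝ} (hγ : IsSmoothJordanCurve γ) (hγΩ : ∀ t, γ t ∈ Ω) (henc : Encircles γ ξ₀) :
    HasAntiperiodicSqrt fun t => f (γ t) := by
  classical
  have hL0 : ∀ ξ, ξ ≠ ξ₀ → L (ξ - ξ₀) ≠ 0 := fun ξ hξ h =>
    hξ (sub_eq_zero.1 ((map_eq_zero_iff L L.injective).1 h))
  -- Invertibility of L makes L (ξ - ξ₀) comparable to ξ - ξ₀, so the remainder of D is negligible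
  -- against it. The quotient therefore extends by 1, without zeros.
  have hlim : Filter.Tendsto (fun ξ => f ξ / L (ξ - ξ₀)) (nhdsWithin ξ₀ {ξ₀}ᶜ) (nhds 1) := by
    have h1 : (fun ξ => D ξ - L (ξ - ξ₀)) =o[nhds ξ₀] fun ξ => L (ξ - ξ₀) := by
      have h2 := hD.isLittleO.trans_isBigO (L.isBigO_sub_rev (nhds ξ₀) ξ₀)
      refine h2.congr_left fun ξ => ?_
      rw [hD0, sub_zero]
      rfl
    have h3 : Asymptotics.IsEquivalent (nhdsWithin ξ₀ {ξ₀}ᶜ) D fun ξ => L (ξ - ξ₀) :=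
      h1.mono nhdsWithin_le_nhds
    rw [Asymptotics.isEquivalent_iff_tendsto_one
      (by filter_upwards [self_mem_nhdsWithin] with ξ hξ using hL0 ξ hξ)] at h3
    refine h3.congr' ?_
    filter_upwards [nhdsWithin_le_nhds hfD] with ξ hξ
    rw [Pi.div_apply, hξ]
  set h : ℝ × ℝ → ℂ := Function.update (fun ξ => f ξ / L (ξ - ξ₀)) ξ₀ 1 with hh
  have hne : ∀ ξ, ξ ≠ ξ₀ → h ξ = f ξ / L (ξ - ξ₀) := fun ξ hξ => Function.update_of_ne hξ _ _
  have hself : h ξ₀ = 1 := Function.update_self _ _ _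
  have hcont : ContinuousOn h Ω := by
    intro ξ hξ
    by_cases hξe : ξ = ξ₀
    · rw [hξe]
      exact (continuousAt_update_same.2 hlim).continuousWithinAt
    · have h1 : ContinuousAt f ξ := hf.continuousAt (hΩ.mem_nhds hξ)
      have h2 : ContinuousAt (fun ξ => f ξ / L (ξ - ξ₀)) ξ :=
        h1.div (by fun_prop) (hL0 ξ hξe)
      exact (continuousAt_update_of_ne hξe |>.2 h2).continuousWithinAt
  have hh0 : (0 : ℂ) ∉ h '' Ω := by
    rintro ⟨ξ, hξ, e⟩
    by_cases hξe : ξ = ξ₀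
    · rw [hξe, hself] at e
      exact one_ne_zero e
    · rw [hne ξ hξe] at e
      exact div_ne_zero (hf0 ξ hξ hξe) (hL0 ξ hξe) e
  obtain ⟨s, hs, hsh⟩ := Complex.exists_continuousOn_pow_eq
    (hconv.isSimplyConnected ⟨ξ₀, hξ₀⟩) hΩ hcont hh0 two_ne_zero
  have hper : HasPeriodicSqrt fun t => h (γ t) :=
    ⟨fun t => s (γ t), hs.comp_continuous hγ.contDiff.continuous hγΩ, fun t => hsh _,
      fun t => by simp only [hγ.period.2.1 t]⟩
  convert (henc.hasAntiperiodicSqrt hγ L).mul hper using 2 with t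
  have ht : γ t ≠ ξ₀ := fun e => henc.1 ⟨t, e⟩
  rw [hne _ ht, mul_div_cancel₀ _ (hL0 _ ht)]

/-! ### Monodromy of continuous branches in grouped spectra. -/

/-- A continuous function with values in a finite disjoint union of continuously varying finite
sets stays in the same one. -/
theorem mem_of_continuous_of_disjoint {ι : Type*} [Finite ι] {G : ι → ℝ → Set ℂ}
    (hfin : ∀ i t, (G i t).Finite)
    (hnear : ∀ i t, ∀ ε > 0, ∀ᶠ s in nhds t, MutuallyNear ε (G i s) (G i t))
    (hdisj : ∀ t i j, i ≠ j → Disjoint (G i t) (G j t)) {x : ℝ → ℂ} (hx : Continuous x)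
    (hcov : ∀ t, ∃ i, x t ∈ G i t) {i : ι} (h0 : x 0 ∈ G i 0) (t : ℝ) : x t ∈ G i t := by
  choose g hg using hcov
  have hloc : IsLocallyConstant g := by
    rw [IsLocallyConstant.iff_eventually_eq]
    intro t
    have h1 : ∀ j, j ≠ g t → ∀ᶠ s in nhds t, x s ∉ G j s := by
      intro j hj
      have hnot : x t ∉ G j t := fun h => Set.disjoint_left.1 (hdisj t j (g t) hj) h (hg t)
      obtain ⟨r, hr, hball⟩ := Metric.isOpen_iff.1 (hfin j t).isClosed.isOpen_compl _ hnot
      filter_upwards [hnear j t (r / 2) (half_pos hr),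
        hx.continuousAt (Metric.ball_mem_nhds (x t) (half_pos hr))] with s hs hxs hmem
      obtain ⟨w, hw, hd⟩ := hs.1 _ hmem
      refine hball (?_ : w ∈ Metric.ball (x t) r) hw
      have hxs' : dist (x s) (x t) < r / 2 := hxs
      rw [Metric.mem_ball]
      rw [dist_comm] at hd
      linarith [dist_triangle w (x s) (x t)]
    have h2 : ∀ᶠ s in nhds t, ∀ j, j ≠ g t → x s ∉ G j s := by
      rw [Filter.eventually_all]
      intro j
      by_cases hj : j = g t
      · exact Filter.Eventually.of_forall fun s h => absurd hj h
      · filter_upwards [h1 j hj] with s hs _ using hs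
    filter_upwards [h2] with s hs
    by_contra hne
    exact hs _ hne (hg s)
  have h3 : g 0 = i := by
    by_contra hne
    exact Set.disjoint_left.1 (hdisj 0 _ _ hne) (hg 0) h0
  rw [← h3, hloc.apply_eq_of_preconnectedSpace 0 t]
  exact hg t

/-- Continuous selections of a continuously varying finite set of constant cardinality that agree
at one point agree everywhere. -/
theorem eq_of_continuous_selections {G : ℝ → Set ℂ} {m : ℕ} (hfin : ∀ t, (G t).Finite)
    (hcard : ∀ t, (G t).ncard = m)
    (hnear : ∀ t, ∀ ε > 0, ∀ᶠ s in nhds t, MutuallyNear ε (G s) (G t)) {x y : ℝ → ℂ}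
    (hx : Continuous x) (hy : Continuous y) (hxG : ∀ t, x t ∈ G t) (hyG : ∀ t, y t ∈ G t)
    (h0 : x 0 = y 0) : x = y := by
  have hcl : IsClosed {t | x t = y t} := isClosed_eq hx hy
  have hop : IsOpen {t | x t = y t} := by
    rw [isOpen_iff_mem_nhds]
    intro t (ht : x t = y t)
    obtain ⟨r, hr, hsep⟩ := (hfin t).exists_separation
    filter_upwards [hnear t r hr, hx.continuousAt (Metric.ball_mem_nhds (x t) hr),
      hy.continuousAt (Metric.ball_mem_nhds (y t) hr)] with s hs hxs hys
    have hys' : dist (y s) (x t) < r := by rw [ht]; exact hys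
    exact eq_of_dist_lt_of_separated (hfin s) (by rw [hcard, hcard]) hsep hs.2 (hxG t) (hxG s)
      (hyG s) hxs hys'
  have := IsClopen.eq_univ ⟨hcl, hop⟩ ⟨0, h0⟩
  funext t
  exact (this ▸ Set.mem_univ t : t ∈ {t | x t = y t})

/-- Two continuous functions that are permuted by the unit shift are exchanged if the square roots
of their squared difference change sign. -/
theorem swap_of_hasAntiperiodicSqrt {x y : ℝ → ℂ} (hx : Continuous x) (hy : Continuous y)
    (hne : ∀ t, x t ≠ y t) (hap : HasAntiperiodicSqrt fun t => (x t - y t) ^ 2)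
    (hx1 : ∀ t, x (t + 1) = x t ∨ x (t + 1) = y t) (hy1 : ∀ t, y (t + 1) = x t ∨ y (t + 1) = y t)
    (t : ℝ) : x (t + 1) = y t ∧ y (t + 1) = x t := by
  obtain ⟨s, hs, hsd, hsa⟩ := hap
  simp only at hsd
  have hd0 : ∀ t, x t - y t ≠ 0 := fun t => sub_ne_zero.2 (hne t)
  have hs0 : ∀ t, s t ≠ 0 := fun t h => hd0 t (pow_eq_zero_iff two_ne_zero |>.1
    (by rw [← hsd, h]; simp))
  -- x - y is itself a continuous root of its square, hence ±s, and so it changes sign over one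
  -- period.
  have hanti : x (t + 1) - y (t + 1) = -(x t - y t) := by
    rcases eqOn_or_eqOn_neg_of_sq_eq (S := Set.univ) (f := fun t => x t - y t) (g := s)
      isPreconnected_univ (by fun_prop) hs.continuousOn (fun t _ => (hsd t).symm)
      (fun t _ => hs0 t) with h | h
    · have h0 := h (Set.mem_univ t)
      have h1 := h (Set.mem_univ (t + 1))
      simp only at h0 h1
      rw [h0, h1, hsa]
    · have h0 := h (Set.mem_univ t)
      have h1 := h (Set.mem_univ (t + 1))
      simp only [Pi.neg_apply] at h0 h1
      rw [h0, h1, hsa]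
  rcases hx1 t with h1 | h1 <;> rcases hy1 t with h2 | h2
  · exact absurd (h1.trans h2.symm) (hne (t + 1))
  · rw [h1, h2] at hanti
    exact absurd (self_eq_neg.1 hanti) (hd0 t)
  · exact ⟨h1, h2⟩
  · exact absurd (h1.trans h2.symm) (hne (t + 1))

theorem sq_sub_eq_of_mem_pair {x y a b : ℂ} (hxy : x ≠ y) (hx : x ∈ ({a, b} : Set ℂ))
    (hy : y ∈ ({a, b} : Set ℂ)) : (x - y) ^ 2 = (a - b) ^ 2 := by
  rcases hx with rfl | rfl <;> rcases hy with rfl | rfl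
  · exact absurd rfl hxy
  · rfl
  · ring
  · exact absurd rfl hxy

/-- A splitting of the eigenvalues into disjoint groups depending continuously on the
parameter. -/
structure IsGroupedLabeling {n : ℕ} {ι : Type*} (Ω : Set (ℝ × ℝ))
    (A : ℝ × ℝ → Matrix (Fin n) (Fin n) ℂ) (lam : Fin n → ℝ × ℝ → ℂ) (J : ι → Set (Fin n)) :
    Prop where
  labeling : IsEigenvalueLabeling Ω A lam
  cont : ∀ a, SetContinuousOn (labelGroup lam (J a)) Ω
  disj : ∀ ξ ∈ Ω, ∀ a b, a ≠ b → Disjoint (labelGroup lam (J a) ξ) (labelGroup lam (J b) ξ)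
  nonempty : ∀ a, (J a).Nonempty
  cover : ∀ j, ∃ a, j ∈ J a

namespace IsGroupedLabeling

variable {n : ℕ} {ι : Type*} {Ω : Set (ℝ × ℝ)} {A : ℝ × ℝ → Matrix (Fin n) (Fin n) ℂ}
  {lam : Fin n → ℝ × ℝ → ℂ} {J : ι → Set (Fin n)}

theorem eq_of_mem (h : IsGroupedLabeling Ω A lam J) {ξ : ℝ × ℝ} (hξ : ξ ∈ Ω) {z : ℂ} {a b : ι}
    (ha : z ∈ labelGroup lam (J a) ξ) (hb : z ∈ labelGroup lam (J b) ξ) : a = b := by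
  by_contra hne
  exact Set.disjoint_left.1 (h.disj ξ hξ a b hne) ha hb

theorem near (h : IsGroupedLabeling Ω A lam J) {ξ : ℝ × ℝ} (hξ : ξ ∈ Ω) (a : ι) {ε : ℝ}
    (hε : 0 < ε) : ∀ᶠ η in nhdsWithin ξ Ω,
      MutuallyNear ε (labelGroup lam (J a) η) (labelGroup lam (J a) ξ) :=
  (h.cont a).eventually_mutuallyNear (labelGroup_finite lam (J a)) (fun _ => (h.nonempty a).image _)
    hξ hε

theorem near_comp (h : IsGroupedLabeling Ω A lam J) {γ : ℝ → ℝ × ℝ} (hγ : Continuous γ)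
    (hγΩ : ∀ t, γ t ∈ Ω) (a : ι) (t : ℝ) {ε : ℝ} (hε : 0 < ε) : ∀ᶠ s in nhds t,
      MutuallyNear ε (labelGroup lam (J a) (γ s)) (labelGroup lam (J a) (γ t)) :=
  (tendsto_nhdsWithin_iff.2 ⟨hγ.continuousAt, Filter.Eventually.of_forall hγΩ⟩).eventually
    (h.near (hγΩ t) a hε)

/-- The squared difference of a pair that coalesces only at a generic cuspidal point has
antiperiodic square roots along a Jordan curve encircling that point. -/
theorem hasAntiperiodicSqrt_pair [Finite ι] (h : IsGroupedLabeling Ω A lam J) {k : ℕ∞}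
    (hA : MatContDiffOn k A Ω) (hΩ : IsOpen Ω) (hconv : Convex ℝ Ω) {ξ₀ : ℝ × ℝ} (hξ₀ : ξ₀ ∈ Ω)
    (hgcp : IsGCP k Ω A ξ₀) {a : ι} {p q : Fin n} (hpq : p ≠ q) (hJ : J a = {p, q})
    (hcoal : lam p ξ₀ = lam q ξ₀) (hne : ∀ ξ ∈ Ω, ξ ≠ ξ₀ → lam p ξ ≠ lam q ξ)
    {γ : ℝ → ℝ × ℝ} (hγ : IsSmoothJordanCurve γ) (hγΩ : ∀ t, γ t ∈ Ω) (henc : Encircles γ ξ₀) :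
    HasAntiperiodicSqrt fun t => (lam p (γ t) - lam q (γ t)) ^ 2 := by
  have hgroup : ∀ ξ, labelGroup lam (J a) ξ = {lam p ξ, lam q ξ} := fun ξ => by
    rw [labelGroup, hJ, Set.image_pair]
  obtain ⟨D, L, hD0, hD, hfD⟩ := (hgcp.sq_sub_eq hA hΩ hξ₀ h.labeling hpq hcoal).2 (by
    intro ε hε
    have h1 : ∀ᶠ ξ in nhds ξ₀, ∀ b,
        MutuallyNear ε (labelGroup lam (J b) ξ) (labelGroup lam (J b) ξ₀) := by
      rw [Filter.eventually_all]
      intro b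
      have := h.near hξ₀ b hε
      rwa [hΩ.nhdsWithin_eq hξ₀] at this
    -- A label other than p, q stays close to a label of its own group at ξ₀. Disjointness of the
    -- groups prevents the latter from being p or q.
    filter_upwards [h1, hΩ.mem_nhds hξ₀] with ξ hξ hξΩ j hjp hjq
    obtain ⟨b, hb⟩ := h.cover j
    obtain ⟨_, ⟨l, hl, rfl⟩, hd⟩ := (hξ b).1 _ ⟨j, hb, rfl⟩
    have hla : l ∉ J a := fun hla => by
      have hab : a = b := h.eq_of_mem hξ₀ (z := lam l ξ₀) ⟨l, hla, rfl⟩ ⟨l, hl, rfl⟩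
      rw [← hab, hJ] at hb
      rcases hb with rfl | rfl
      · exact hjp rfl
      · exact hjq rfl
    rw [hJ] at hla
    exact ⟨l, fun e => hla (Or.inl e), fun e => hla (Or.inr e), hd⟩)
  refine hasAntiperiodicSqrt_comp hΩ hconv hξ₀ (continuousOn_sq_sub fun ξ hξ ε hε => ?_)
    (fun ξ hξ hξe => pow_ne_zero 2 (sub_ne_zero.2 (hne ξ hξ hξe))) hD0 hD hfD hγ hγΩ henc
  simpa only [hgroup] using h.near hξ a hε

end IsGroupedLabeling

/-- Continuous labels of the eigenvalues along a curve, compatible with the grouping. -/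
structure IsContinuousLabeling {n : ℕ} {ι : Type*} (lam : Fin n → ℝ × ℝ → ℂ) (J : ι → Set (Fin n))
    (γ : ℝ → ℝ × ℝ) (x : Fin n → ℝ → ℂ) : Prop where
  cont : ∀ j, Continuous (x j)
  inj : ∀ t, Function.Injective fun j => x j t
  image : ∀ a t, (fun j => x j t) '' J a = labelGroup lam (J a) (γ t)

/-- The relabeling is fixed at t = 0. Afterwards each continuous branch stays in its group, since
the groups are disjoint and vary continuously. -/
theorem IsGroupedLabeling.exists_isContinuousLabeling {n : ℕ} {ι : Type*} [Finite ι]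
    {Ω : Set (ℝ × ℝ)} {A : ℝ × ℝ → Matrix (Fin n) (Fin n) ℂ} {lam : Fin n → ℝ × ℝ → ℂ}
    {J : ι → Set (Fin n)} (h : IsGroupedLabeling Ω A lam J) {γ : ℝ → ℝ × ℝ} (hγ : Continuous γ)
    (hγΩ : ∀ t, γ t ∈ Ω) (hsimple : ∀ t, SimpleSpectrum (A (γ t))) {Lam : Fin n → ℝ → ℂ}
    (hLam : ∀ j, Continuous (Lam j))
    (hchar : ∀ t, (A (γ t)).charpoly = ∏ j, (Polynomial.X - Polynomial.C (Lam j t))) :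
    (∀ t, Function.Injective fun j => Lam j t) ∧
      ∃ σ : Equiv.Perm (Fin n), IsContinuousLabeling lam J γ fun j => Lam (σ j) := by
  have hmap : ∀ t, (Finset.univ.val.map fun j => Lam j t) =
      Finset.univ.val.map fun j => lam j (γ t) := fun t => by
    rw [← h.labeling.roots_eq (hγΩ t), hchar, roots_prod_X_sub_C_univ]
  have hinj : ∀ t, Function.Injective fun j => Lam j t := by
    intro t i j e
    have hs := hsimple t
    rw [SimpleSpectrum, hchar, roots_prod_X_sub_C_univ] at hs
    exact Multiset.inj_on_of_nodup_map hs i (Finset.mem_univ i) j (Finset.mem_univ j) e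
  have hex1 : ∀ t j, ∃ l, lam l (γ t) = Lam j t := by
    intro t j
    have : Lam j t ∈ Finset.univ.val.map fun j => lam j (γ t) := by
      rw [← hmap]; exact Multiset.mem_map_of_mem _ (Finset.mem_univ j)
    obtain ⟨l, -, hl⟩ := Multiset.mem_map.1 this
    exact ⟨l, hl⟩
  have hex2 : ∀ t j, ∃ l, Lam l t = lam j (γ t) := by
    intro t j
    have : lam j (γ t) ∈ Finset.univ.val.map fun j => Lam j t := by
      rw [hmap]; exact Multiset.mem_map_of_mem _ (Finset.mem_univ j)
    obtain ⟨l, -, hl⟩ := Multiset.mem_map.1 this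
    exact ⟨l, hl⟩
  choose σ₀ hσ₀ using hex2 0
  have hσinj : Function.Injective σ₀ := fun i j e => by
    refine h.labeling.injective (hγΩ 0) (hsimple 0) ?_
    simp only [← hσ₀, e]
  set σ : Equiv.Perm (Fin n) := Equiv.ofBijective σ₀ (Finite.injective_iff_bijective.1 hσinj)
  have hσ : ∀ j, Lam (σ j) 0 = lam j (γ 0) := hσ₀
  have hmem : ∀ a, ∀ j ∈ J a, ∀ t, Lam (σ j) t ∈ labelGroup lam (J a) (γ t) := by
    intro a j hj t
    refine mem_of_continuous_of_disjoint (G := fun a t => labelGroup lam (J a) (γ t))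
      (fun a t => labelGroup_finite _ _ _) (fun a t ε hε => h.near_comp hγ hγΩ a t hε)
      (fun t => h.disj _ (hγΩ t)) (hLam (σ j)) (fun t => ?_) ?_ t
    · obtain ⟨l, hl⟩ := hex1 t (σ j)
      obtain ⟨a, ha⟩ := h.cover l
      exact ⟨a, l, ha, hl⟩
    · exact ⟨j, hj, (hσ j).symm⟩
  refine ⟨hinj, σ, fun j => hLam _, fun t => (hinj t).comp σ.injective, fun a t => ?_⟩
  apply subset_antisymm
  · rintro _ ⟨j, hj, rfl⟩
    exact hmem a j hj t
  · rintro _ ⟨l, hl, rfl⟩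
    obtain ⟨i, hi⟩ := hex2 t l
    obtain ⟨j, rfl⟩ := σ.surjective i
    obtain ⟨b, hb⟩ := h.cover j
    have hab : a = b := h.eq_of_mem (hγΩ t) (z := lam l (γ t)) ⟨l, hl, rfl⟩
      (by rw [← hi]; exact hmem b j hb t)
    subst hab
    exact ⟨j, hb, hi⟩

namespace IsContinuousLabeling

variable {n : ℕ} {ι : Type*} {lam : Fin n → ℝ × ℝ → ℂ} {J : ι → Set (Fin n)}
  {γ : ℝ → ℝ × ℝ} {x : Fin n → ℝ → ℂ}

theorem mem (hx : IsContinuousLabeling lam J γ x) {a : ι} {j : Fin n} (hj : j ∈ J a) (t : ℝ) :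
    x j t ∈ labelGroup lam (J a) (γ t) := by
  rw [← hx.image]
  exact ⟨j, hj, rfl⟩

theorem swap (hx : IsContinuousLabeling lam J γ x) (hper : ∀ t, γ (t + 1) = γ t)
    {a : ι} {p q : Fin n} (hpq : p ≠ q) (hJ : J a = {p, q})
    (hap : HasAntiperiodicSqrt fun t => (lam p (γ t) - lam q (γ t)) ^ 2) (t : ℝ) :
    x p (t + 1) = x q t ∧ x q (t + 1) = x p t := by
  have hne : ∀ t, x p t ≠ x q t := fun t e => hpq (hx.inj t e)
  have hp : p ∈ J a := by rw [hJ]; exact Or.inl rfl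
  have hq : q ∈ J a := by rw [hJ]; exact Or.inr rfl
  have hsq : ∀ t, (x p t - x q t) ^ 2 = (lam p (γ t) - lam q (γ t)) ^ 2 := by
    intro t
    have h1 := hx.mem hp t
    have h2 := hx.mem hq t
    rw [labelGroup, hJ, Set.image_pair] at h1 h2
    exact sq_sub_eq_of_mem_pair (hne t) h1 h2
  have hshift : ∀ j ∈ J a, ∀ t, x j (t + 1) = x p t ∨ x j (t + 1) = x q t := by
    intro j hj t
    have h1 := hx.mem hj (t + 1)
    rw [hper, ← hx.image, hJ, Set.image_pair] at h1
    exact h1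
  exact swap_of_hasAntiperiodicSqrt (hx.cont p) (hx.cont q) hne (by simpa only [hsq] using hap)
    (hshift p hp) (hshift q hq) t

/-- Eigenvalues in a group without coalescence have no monodromy. -/
theorem periodic (hx : IsContinuousLabeling lam J γ x) {Ω : Set (ℝ × ℝ)}
    {A : ℝ × ℝ → Matrix (Fin n) (Fin n) ℂ} (h : IsGroupedLabeling Ω A lam J) (hΩ : IsOpen Ω)
    (hconv : Convex ℝ Ω) (hγ : Continuous γ) (hγΩ : ∀ t, γ t ∈ Ω) (hper : ∀ t, γ (t + 1) = γ t)
    {a : ι} (hinj : ∀ ξ ∈ Ω, Set.InjOn (fun j => lam j ξ) (J a)) {j : Fin n} (hj : j ∈ J a)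
    (t : ℝ) : x j (t + 1) = x j t := by
  have : SimplyConnectedSpace Ω := (hconv.isSimplyConnected ⟨γ 0, hγΩ 0⟩).simplyConnectedSpace
  have := hΩ.locallyPathConnectedSpace
  have hcard : ∀ ξ ∈ Ω, (labelGroup lam (J a) ξ).ncard = (J a).ncard :=
    fun ξ hξ => (hinj ξ hξ).ncard_image
  -- The branch through x j 0 is single valued over all of Ω. Along γ it must coincide with x j,
  -- which thereby inherits the period of γ.
  obtain ⟨μ, hμ, hμG, hμ0⟩ := exists_continuous_selection (X := Ω)
    (G := fun ξ => labelGroup lam (J a) ξ) (fun ξ => labelGroup_finite _ _ _)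
    (fun ξ => hcard ξ ξ.2)
    (fun ξ ε hε => (eventually_nhds_subtype_iff Ω ξ
      fun η => MutuallyNear ε (labelGroup lam (J a) η) (labelGroup lam (J a) ξ)).2
        (h.near ξ.2 a hε))
    (x₀ := ⟨γ 0, hγΩ 0⟩) (hx.mem hj 0)
  have heq : x j = fun t => μ ⟨γ t, hγΩ t⟩ :=
    eq_of_continuous_selections (G := fun t => labelGroup lam (J a) (γ t))
      (fun t => labelGroup_finite _ _ _) (fun t => hcard _ (hγΩ t))
      (fun t ε hε => h.near_comp hγ hγΩ a t hε) (hx.cont j)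
      (hμ.comp (hγ.subtype_mk hγΩ)) (hx.mem hj) (fun t => hμG ⟨γ t, hγΩ t⟩) hμ0.symm
  simp only [heq, hper]

end IsContinuousLabeling

/-! ### The double swap and the final assembly. -/

theorem pairSwap_castLE {n : ℕ} (hn : 5 ≤ n) :
    pairSwap hn (Fin.castLE hn 0) = Fin.castLE hn 1 ∧
    pairSwap hn (Fin.castLE hn 1) = Fin.castLE hn 0 ∧
    pairSwap hn (Fin.castLE hn 2) = Fin.castLE hn 3 ∧
    pairSwap hn (Fin.castLE hn 3) = Fin.castLE hn 2 := by
  simp [pairSwap, Equiv.swap_apply_def, Fin.ext_iff]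

theorem pairSwap_of_mem_restIndices {n : ℕ} (hn : 5 ≤ n) {j : Fin n} (hj : j ∈ restIndices n) :
    pairSwap hn j = j := by
  have hj' : 4 ≤ j.val := hj
  have h : ∀ i : Fin 5, i.val < 4 → j ≠ Fin.castLE hn i := by
    rintro i hi rfl
    rw [Fin.val_castLE] at hj'
    omega
  rw [pairSwap, Equiv.Perm.mul_apply, Equiv.swap_apply_of_ne_of_ne (h 2 (by simp)) (h 3 (by simp)),
    Equiv.swap_apply_of_ne_of_ne (h 0 (by simp)) (h 1 (by simp))]

theorem sign_pairSwap {n : ℕ} (hn : 5 ≤ n) : Equiv.Perm.sign (pairSwap hn) = 1 := by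
  rw [pairSwap, Equiv.Perm.sign_mul, Equiv.Perm.sign_swap (by simp [Fin.ext_iff]),
    Equiv.Perm.sign_swap (by simp [Fin.ext_iff])]
  rfl

theorem firstPair_eq {n : ℕ} (hn : 5 ≤ n) :
    firstPair n = {Fin.castLE hn 0, Fin.castLE hn 1} := by
  ext j
  simp only [firstPair, Set.mem_ofPred_eq, Set.mem_insert_iff, Set.mem_singleton_iff, Fin.ext_iff,
    Fin.val_castLE]
  change j.val < 2 ↔ j.val = 0 ∨ j.val = 1
  omega

theorem secondPair_eq {n : ℕ} (hn : 5 ≤ n) :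
    secondPair n = {Fin.castLE hn 2, Fin.castLE hn 3} := by
  ext j
  simp only [secondPair, Set.mem_ofPred_eq, Set.mem_insert_iff, Set.mem_singleton_iff, Fin.ext_iff,
    Fin.val_castLE]
  change 2 ≤ j.val ∧ j.val < 4 ↔ j.val = 2 ∨ j.val = 3
  omega

theorem mem_pair_or_mem_restIndices {n : ℕ} (j : Fin n) :
    j ∈ firstPair n ∨ j ∈ secondPair n ∨ j ∈ restIndices n := by
  simp only [firstPair, secondPair, restIndices, Set.mem_ofPred_eq]
  omega

theorem theorem3p11 (n : ℕ) (hn : 5 ≤ n) (k : ℕ∞) (hk : 1 ≤ k)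
    (Ω : Set (ℝ × ℝ)) (hΩ_open : IsOpen Ω) (hΩ_convex : Convex ℝ Ω)
    (A : ℝ × ℝ → Matrix (Fin n) (Fin n) ℂ) (hA : MatContDiffOn k A Ω)
    -- the eigenvalues, in three mutually disjoint groups that depend continuously on the parameter
    (lam : Fin n → ℝ × ℝ → ℂ) (hlam : IsEigenvalueLabeling Ω A lam)
    (hcont₁ : SetContinuousOn (labelGroup lam (firstPair n)) Ω)
    (hcont₂ : SetContinuousOn (labelGroup lam (secondPair n)) Ω)
    (hcont₃ : SetContinuousOn (labelGroup lam (restIndices n)) Ω)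
    (hdisj₁₂ : ∀ ξ ∈ Ω, Disjoint (labelGroup lam (firstPair n) ξ) (labelGroup lam (secondPair n) ξ))
    (hdisj₁₃ : ∀ ξ ∈ Ω, Disjoint (labelGroup lam (firstPair n) ξ) (labelGroup lam (restIndices n) ξ))
    (hdisj₂₃ : ∀ ξ ∈ Ω, Disjoint (labelGroup lam (secondPair n) ξ) (labelGroup lam (restIndices n) ξ))
    -- the two generic cuspidal points
    (ξ₀ ξ₁ : ℝ × ℝ) (hξ₀ : ξ₀ ∈ Ω) (hξ₁ : ξ₁ ∈ Ω) (hne : ξ₀ ≠ ξ₁)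
    (hgcp₀ : IsGCP k Ω A ξ₀) (hgcp₁ : IsGCP k Ω A ξ₁)
    (hcoal₀ : lam (Fin.castLE hn 0) ξ₀ = lam (Fin.castLE hn 1) ξ₀)
    (hcoal₁ : lam (Fin.castLE hn 2) ξ₁ = lam (Fin.castLE hn 3) ξ₁)
    (hsimple : ∀ ξ ∈ Ω, ξ ≠ ξ₀ → ξ ≠ ξ₁ → SimpleSpectrum (A ξ))
    -- the loop
    (γ : ℝ → ℝ × ℝ) (hγ : IsSmoothJordanCurve γ) (hγΩ : ∀ t, γ t ∈ Ω)
    (henc₀ : Encircles γ ξ₀) (henc₁ : Encircles γ ξ₁)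
    (hAγ : HasMinimalPeriod (fun t => A (γ t)) 1)
    -- the eigendecomposition along the loop; eigenvectors belonging to the same pair are normalized
    -- to the same length at `t = 0`
    (V : ℝ → Matrix (Fin n) (Fin n) ℂ) (Lam : Fin n → ℝ → ℂ)
    (hV : IsTransportedEigendecomposition k (fun t => A (γ t)) V Lam)
    (hnorm₁ : ∀ i j, Lam i 0 ∈ labelGroup lam (firstPair n) (γ 0) →
      Lam j 0 ∈ labelGroup lam (firstPair n) (γ 0) → colNormSq (V 0) i = colNormSq (V 0) j)
    (hnorm₂ : ∀ i j, Lam i 0 ∈ labelGroup lam (secondPair n) (γ 0) →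
      Lam j 0 ∈ labelGroup lam (secondPair n) (γ 0) → colNormSq (V 0) i = colNormSq (V 0) j) :
    -- `σ` relabels the eigenvalues and, accordingly, the columns of `V`
    ∃ (σ : Equiv.Perm (Fin n)) (α : Fin n → ℝ),
      -- the new labels respect the three groups
      (∀ t, ∀ J ∈ ({firstPair n, secondPair n, restIndices n} : Set (Set (Fin n))),
        (fun j => Lam (σ j) t) '' J = labelGroup lam J (γ t)) ∧
      (∀ t, Lam (σ (Fin.castLE hn 0)) (t + 1) = Lam (σ (Fin.castLE hn 1)) t ∧
        Lam (σ (Fin.castLE hn 1)) (t + 1) = Lam (σ (Fin.castLE hn 0)) t) ∧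
      (∀ t, Lam (σ (Fin.castLE hn 2)) (t + 1) = Lam (σ (Fin.castLE hn 3)) t ∧
        Lam (σ (Fin.castLE hn 3)) (t + 1) = Lam (σ (Fin.castLE hn 2)) t) ∧
      (∀ t, ∀ j ∈ restIndices n, Lam (σ j) (t + 1) = Lam (σ j) t) ∧
      (∀ t, ((V t).submatrix id σ)⁻¹ * (V (t + 1)).submatrix id σ = twoSwapPhaseMatrix hn α) ∧
      ∃ m : ℤ, ∑ j, α j = 2 * Real.pi * m := by
  set i₀ := Fin.castLE hn 0 with hi₀
  set i₁ := Fin.castLE hn 1 with hi₁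
  set i₂ := Fin.castLE hn 2 with hi₂
  set i₃ := Fin.castLE hn 3 with hi₃
  have h01 : i₀ ≠ i₁ := by simp [hi₀, hi₁, Fin.ext_iff]
  have h23 : i₂ ≠ i₃ := by simp [hi₂, hi₃, Fin.ext_iff]
  have h20 : i₂ ≠ i₀ := by simp [hi₂, hi₀, Fin.ext_iff]
  have h21 : i₂ ≠ i₁ := by simp [hi₂, hi₁, Fin.ext_iff]
  have h03 : i₀ ≠ i₃ := by simp [hi₀, hi₃, Fin.ext_iff]
  have hF := firstPair_eq hn
  have hS := secondPair_eq hn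
  have m0 : i₀ ∈ firstPair n := by rw [hF]; exact Or.inl rfl
  have m1 : i₁ ∈ firstPair n := by rw [hF]; exact Or.inr rfl
  have m2 : i₂ ∈ secondPair n := by rw [hS]; exact Or.inl rfl
  have m3 : i₃ ∈ secondPair n := by rw [hS]; exact Or.inr rfl
  have hrest : ∀ j ∈ restIndices n, j ≠ i₀ ∧ j ≠ i₁ ∧ j ≠ i₂ ∧ j ≠ i₃ := by
    intro j (hj : 4 ≤ j.val)
    simp only [hi₀, hi₁, hi₂, hi₃, Ne, Fin.ext_iff, Fin.val_castLE]
    refine ⟨?_, ?_, ?_, ?_⟩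
    · change ¬ j.val = 0; omega
    · change ¬ j.val = 1; omega
    · change ¬ j.val = 2; omega
    · change ¬ j.val = 3; omega
  set J : Fin 3 → Set (Fin n) := ![firstPair n, secondPair n, restIndices n] with hJ
  have hG : IsGroupedLabeling Ω A lam J := by
    refine ⟨hlam, fun a => ?_, fun ξ hξ a b hab => ?_, fun a => ?_, fun j => ?_⟩
    · fin_cases a
      exacts [hcont₁, hcont₂, hcont₃]
    · fin_cases a <;> fin_cases b
      exacts [absurd rfl hab, hdisj₁₂ ξ hξ, hdisj₁₃ ξ hξ, (hdisj₁₂ ξ hξ).symm, absurd rfl hab,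
        hdisj₂₃ ξ hξ, (hdisj₁₃ ξ hξ).symm, (hdisj₂₃ ξ hξ).symm, absurd rfl hab]
    · fin_cases a
      · exact ⟨i₀, m0⟩
      · exact ⟨i₂, m2⟩
      · exact ⟨Fin.castLE hn 4, le_refl 4⟩
    · rcases mem_pair_or_mem_restIndices j with h | h | h
      exacts [⟨0, h⟩, ⟨1, h⟩, ⟨2, h⟩]
  have hg₀ := (hgcp₀.sq_sub_eq hA hΩ_open hξ₀ hlam h01 hcoal₀).1
  have hg₁ := (hgcp₁.sq_sub_eq hA hΩ_open hξ₁ hlam h23 hcoal₁).1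
  -- At the other cuspidal point only that point's own pair coincides, so each pair coalesces at its
  -- own point alone.
  have hne01 : ∀ ξ ∈ Ω, ξ ≠ ξ₀ → lam i₀ ξ ≠ lam i₁ ξ := by
    intro ξ hξ hξ0 e
    by_cases hξ1 : ξ = ξ₁
    · subst hξ1
      rcases hg₁ i₀ i₁ e h01 with h | h
      exacts [h20 h.symm, h03 h]
    · exact h01 (hlam.injective hξ (hsimple ξ hξ hξ0 hξ1) e)
  have hne23 : ∀ ξ ∈ Ω, ξ ≠ ξ₁ → lam i₂ ξ ≠ lam i₃ ξ := by
    intro ξ hξ hξ1 e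
    by_cases hξ0 : ξ = ξ₀
    · subst hξ0
      rcases hg₀ i₂ i₃ e h23 with h | h
      exacts [h20 h, h21 h]
    · exact h23 (hlam.injective hξ (hsimple ξ hξ hξ0 hξ1) e)
  have hinjrest : ∀ ξ ∈ Ω, Set.InjOn (fun j => lam j ξ) (J 2) := by
    intro ξ hξ i hi j hj e
    obtain ⟨r0, r1, r2, r3⟩ := hrest i hi
    by_contra hij
    by_cases hξ0 : ξ = ξ₀
    · subst hξ0
      rcases hg₀ i j e hij with h | h
      exacts [r0 h, r1 h]
    by_cases hξ1 : ξ = ξ₁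
    · subst hξ1
      rcases hg₁ i j e hij with h | h
      exacts [r2 h, r3 h]
    · exact hij (hlam.injective hξ (hsimple ξ hξ hξ0 hξ1) e)
  have hγc : Continuous γ := hγ.contDiff.continuous
  have hγp : ∀ t, γ (t + 1) = γ t := hγ.period.2.1
  have hchar : ∀ t, (A (γ t)).charpoly = ∏ j, (Polynomial.X - Polynomial.C (Lam j t)) := fun t => by
    rw [Matrix.charpoly_eq_of_eq_conj (hV.isUnit_det t) (hV.decomposition t),
      Matrix.charpoly_diagonal]
  obtain ⟨hinjLam, σ, hx⟩ := hG.exists_isContinuousLabeling hγc hγΩ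
    (fun t => hsimple _ (hγΩ t) (fun e => henc₀.1 ⟨t, e⟩) (fun e => henc₁.1 ⟨t, e⟩))
    (fun j => (hV.contDiff_values j).continuous) hchar
  have hswap01 := hx.swap hγp (a := 0) h01 hF
    (hG.hasAntiperiodicSqrt_pair hA hΩ_open hΩ_convex hξ₀ hgcp₀ (a := 0) h01 hF hcoal₀ hne01 hγ hγΩ
      henc₀)
  have hswap23 := hx.swap hγp (a := 1) h23 hS
    (hG.hasAntiperiodicSqrt_pair hA hΩ_open hΩ_convex hξ₁ hgcp₁ (a := 1) h23 hS hcoal₁ hne23 hγ hγΩ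
      henc₁)
  have hperrest : ∀ t, ∀ j ∈ restIndices n, Lam (σ j) (t + 1) = Lam (σ j) t := fun t j hj =>
    hx.periodic (a := 2) hG hΩ_open hΩ_convex hγc hγΩ hγp hinjrest hj t
  obtain ⟨ps0, ps1, ps2, ps3⟩ := pairSwap_castLE hn
  have hLamσ : ∀ t j, Lam (σ j) (t + 1) = Lam (σ (pairSwap hn j)) t := by
    intro t j
    rcases mem_pair_or_mem_restIndices j with h | h | h
    · rw [hF] at h
      rcases h with rfl | rfl
      · rw [ps0]; exact (hswap01 t).1
      · rw [ps1]; exact (hswap01 t).2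
    · rw [hS] at h
      rcases h with rfl | rfl
      · rw [ps2]; exact (hswap23 t).1
      · rw [ps3]; exact (hswap23 t).2
    · rw [pairSwap_of_mem_restIndices hn h, hperrest t j h]
  have hnormσ : ∀ j, colNormSq (V 0) (σ j) = colNormSq (V 0) (σ (pairSwap hn j)) := by
    intro j
    rcases mem_pair_or_mem_restIndices j with h | h | h
    · rw [hF] at h
      rcases h with rfl | rfl
      · rw [ps0]; exact hnorm₁ _ _ (hx.mem (a := 0) m0 0) (hx.mem (a := 0) m1 0)
      · rw [ps1]; exact hnorm₁ _ _ (hx.mem (a := 0) m1 0) (hx.mem (a := 0) m0 0)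
    · rw [hS] at h
      rcases h with rfl | rfl
      · rw [ps2]; exact hnorm₂ _ _ (hx.mem (a := 1) m2 0) (hx.mem (a := 1) m3 0)
      · rw [ps3]; exact hnorm₂ _ _ (hx.mem (a := 1) m3 0) (hx.mem (a := 1) m2 0)
    · rw [pairSwap_of_mem_restIndices hn h]
  -- The columns of V keep their original indices here, so the double swap is conjugated by σ; its
  -- sign is unaffected.
  set π : Equiv.Perm (Fin n) := σ * pairSwap hn * σ⁻¹ with hπ
  have hπσ : ∀ j, π (σ j) = σ (pairSwap hn j) := fun j => by simp [hπ]
  obtain ⟨c, hc⟩ := hV.exists_coeff (fun t => by rw [hγp]) hinjLam π (fun t j => by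
    obtain ⟨j, rfl⟩ := σ.surjective j
    rw [hπσ, hLamσ])
  obtain ⟨α, hα, m, hm⟩ := hV.exists_phases hk π c hc
    (fun j => by
      obtain ⟨j, rfl⟩ := σ.surjective j
      rw [hπσ, hnormσ])
    (by simp [hπ, sign_pairSwap])
  refine ⟨σ, fun j => α (σ j), ?_, hswap01, hswap23, hperrest, fun t => ?_, m, ?_⟩
  · rintro t _ (rfl | rfl | rfl)
    exacts [hx.image 0 t, hx.image 1 t, hx.image 2 t]
  · have hdet : IsUnit ((V t).submatrix id σ).det := by
      rw [Matrix.det_permute']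
      exact ((Equiv.Perm.sign σ).isUnit.map (Int.castRingHom ℂ)).mul (hV.isUnit_det t)
    have hmul : (V (t + 1)).submatrix id σ =
        (V t).submatrix id σ * twoSwapPhaseMatrix hn fun j => α (σ j) := by
      ext r j
      rw [Matrix.mul_apply, Finset.sum_eq_single (pairSwap hn j)
        (fun i _ hi => by rw [twoSwapPhaseMatrix, Matrix.of_apply, if_neg hi, mul_zero])
        (fun h => absurd (Finset.mem_univ _) h)]
      rw [twoSwapPhaseMatrix, Matrix.of_apply, if_pos rfl, Matrix.submatrix_apply,
        Matrix.submatrix_apply, id, hc, hα, hπσ, mul_comm]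
    rw [hmul, ← Matrix.mul_assoc, Matrix.nonsing_inv_mul _ hdet, Matrix.one_mul]
  · rw [Equiv.sum_comp σ α, hm]
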